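/- A CNF formula $F=(V,C)$ consists of a finite set $C$ of non-empty clauses (a clause is a finite set of literals), each clause $c\in C$ with a positive integer weight $w(c)$, and the set $V$ of all variables that occur in the clauses of $C$. For a set $D$ of clauses write $w(D)=\sum_{c\in D}w(c)$, and let $\mathrm{sat}(F)$ be the maximum, over all truth assignments $V\to\{\text{true},\text{false}\}$, of the total weight of the satisfied clauses. The formula is unit-conflict free (UCF) if for no variable $x$ both unit clauses $(x)$ and $(\bar x)$ belong to $C$. A subformula of $F$ is a formula $F'=(V',C')$ with $C'\subseteq C$, with the same weights on $C'$, and with $V'$ the set of variables that occur in $C'$. Let $\varphi=(\sqrt5-1)/2$. Every UCF formula $F=(V,C)$ contains a (possibly empty) subformula $F'=(V',C')$ such that $$\mathrm{sat}(F)\ \ge\ \varphi\, w(C)+(1-\varphi)\,w(C')+\frac{(2-3\varphi)\,|V\setminus V'|}{2},$$ and there is an algorithm that finds such an $F'$, given a list of the weighted clauses of $F$ as input, in time polynomial in the bit length of that list (weights and names of variables written in binary). -/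

import Mathlib

namespace MaxSat

/-! ### CNF formulas with integer clause weights -/

/-- `(x, true)` is the positive literal `x`, and `(x, false)` is the negative literal of `x`.
Variables are named by natural numbers. -/
abbrev Literal := ℕ × Bool

/-- A clause is a finite set of literals (their disjunction). -/
abbrev Clause := Finset Literal

/-- A CNF formula: a finite set of non-empty clauses, each with a positive integer weight (its
multiplicity).  The weight of a clause that does not belong to the formula is `0`. -/
@[ext] structure CNF where
  clauses : Finset Clause
  weight : Clause → ℕ
  nonempty : ∀ c ∈ clauses, c.Nonempty
  weight_pos : ∀ c ∈ clauses, 0 < weight c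
  weight_eq_zero : ∀ c, c ∉ clauses → weight c = 0

namespace CNF

/-- The set `V` of variables of a formula: the variables that occur in its clauses. -/
def vars (F : CNF) : Finset ℕ :=
  F.clauses.biUnion fun c => c.image Prod.fst

/-- `w(C)`: the total weight of the clauses of the formula. -/
def totalWeight (F : CNF) : ℕ :=
  ∑ c ∈ F.clauses, F.weight c

/-- The truth assignment `α : V → {true, false}` satisfies the clause `c`. -/
def Satisfies (F : CNF) (α : F.vars → Bool) (c : Clause) : Prop :=
  ∃ x : F.vars, ((x : ℕ), α x) ∈ c

open Classical in
/-- The weight of a truth assignment: the total weight of the clauses that it satisfies. -/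
noncomputable def assignmentWeight (F : CNF) (α : F.vars → Bool) : ℕ :=
  ∑ c ∈ F.clauses with F.Satisfies α c, F.weight c

/-- `sat(F)`: the maximum weight of a truth assignment (there are finitely many of them, and at
least one). -/
noncomputable def sat (F : CNF) : ℕ :=
  Finset.univ.sup F.assignmentWeight

/-- Unit-conflict free: there is no pair of unit clauses `(x)`, `(¬ x)`. -/
def UnitConflictFree (F : CNF) : Prop :=
  ∀ x : ℕ, ¬ (({(x, true)} : Clause) ∈ F.clauses ∧ ({(x, false)} : Clause) ∈ F.clauses)

/-- `F'` is a subformula of `F`: its clauses are clauses of `F`, with the same weights. -/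
def IsSubformula (F' F : CNF) : Prop :=
  F'.clauses ⊆ F.clauses ∧ ∀ c ∈ F'.clauses, F'.weight c = F.weight c

end CNF

/-- Formulas as written down for an algorithm: a list of weighted clauses, where a clause is a
list of literals. -/
abbrev ClauseList := List (ℕ × List Literal)

/-- The list `L` is a way to write down the formula `F`.  Clauses and literals may be listed in any
order and repeatedly; the weight of a clause is the sum of the weights of its occurrences. -/
def Presents (L : ClauseList) (F : CNF) : Prop :=
  (∀ e ∈ L, 0 < e.1) ∧
  F.clauses = (L.map fun e => e.2.toFinset).toFinset ∧
  ∀ c, F.weight c = ((L.filter fun e => e.2.toFinset = c).map Prod.fst).sum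

/-- The sequence of numbers by which a list of weighted clauses is given to a machine: for each
clause its weight, the number of its literals, and then for each literal the name of the variable
followed by the sign (`1` for positive, `0` for negative). -/
def encode (L : ClauseList) : List ℕ :=
  L.flatMap fun e => e.1 :: e.2.length :: e.2.flatMap fun l => [l.1, l.2.toNat]

/-! ### Random access machines and polynomial time

Programs for a random access machine with registers and arrays of natural numbers.  An elementary
instruction takes one step.  As the only arithmetic is addition and truncated subtraction, `t` steps
lengthen the binary expansions of the numbers involved by at most `O(t)`, so that polynomial time
on this machine, measured in the bit length of the input, is polynomial time on a Turing machine. -/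

/-- The memory: registers `reg x`, and arrays whose entries are `arr a i`. -/
@[ext] structure Memory where
  reg : ℕ → ℕ
  arr : ℕ → ℕ → ℕ

namespace Memory

def setReg (s : Memory) (x v : ℕ) : Memory :=
  { s with reg := Function.update s.reg x v }

def setArr (s : Memory) (a i v : ℕ) : Memory :=
  { s with arr := Function.update s.arr a (Function.update (s.arr a) i v) }

/-- At the start, array `0` holds the input and register `0` its length; all else is `0`. -/
def init (input : List ℕ) : Memory where
  reg x := if x = 0 then input.length else 0
  arr a i := if a = 0 then input.getD i 0 else 0

/-- At the end, register `0` holds the length of the output, and array `0` the output. -/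
def output (s : Memory) : List ℕ :=
  (List.range (s.reg 0)).map (s.arr 0)

end Memory

/-- Programs.  The registers and arrays that are used by a program are fixed by it; only the
positions in an array are computed during the run. -/
inductive Program where
  | skip : Program
  /-- `reg x := n` -/
  | const (x n : ℕ) : Program
  /-- `reg x := reg y + reg z` -/
  | add (x y z : ℕ) : Program
  /-- `reg x := max (reg y - reg z) 0` -/
  | sub (x y z : ℕ) : Program
  /-- `reg x := arr a (reg y)` -/
  | load (x a y : ℕ) : Program
  /-- `arr a (reg y) := reg x` -/
  | store (a y x : ℕ) : Program
  /-- first `p`, then `q` -/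
  | seq (p q : Program) : Program
  /-- if `reg x ≠ 0` then `p` else `q` -/
  | cond (x : ℕ) (p q : Program) : Program
  /-- while `reg x ≠ 0` do `p` -/
  | loop (x : ℕ) (p : Program) : Program

/-- `Runs p s s' t`: started in the memory `s`, the program `p` halts after exactly `t` steps with
the memory `s'`.  An instruction takes one step, and so does each test in a conditional or loop. -/
inductive Runs : Program → Memory → Memory → ℕ → Prop where
  | skip (s : Memory) : Runs .skip s s 1
  | const (x n : ℕ) (s : Memory) : Runs (.const x n) s (s.setReg x n) 1
  | add (x y z : ℕ) (s : Memory) : Runs (.add x y z) s (s.setReg x (s.reg y + s.reg z)) 1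
  | sub (x y z : ℕ) (s : Memory) : Runs (.sub x y z) s (s.setReg x (s.reg y - s.reg z)) 1
  | load (x a y : ℕ) (s : Memory) : Runs (.load x a y) s (s.setReg x (s.arr a (s.reg y))) 1
  | store (a y x : ℕ) (s : Memory) : Runs (.store a y x) s (s.setArr a (s.reg y) (s.reg x)) 1
  | seq {p q : Program} {s₁ s₂ s₃ : Memory} {t₁ t₂ : ℕ} (hp : Runs p s₁ s₂ t₁)
      (hq : Runs q s₂ s₃ t₂) : Runs (.seq p q) s₁ s₃ (t₁ + t₂)
  | cond_pos {x : ℕ} {p q : Program} {s₁ s₂ : Memory} {t : ℕ} (hx : s₁.reg x ≠ 0)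
      (hp : Runs p s₁ s₂ t) : Runs (.cond x p q) s₁ s₂ (t + 1)
  | cond_zero {x : ℕ} {p q : Program} {s₁ s₂ : Memory} {t : ℕ} (hx : s₁.reg x = 0)
      (hq : Runs q s₁ s₂ t) : Runs (.cond x p q) s₁ s₂ (t + 1)
  | loop_pos {x : ℕ} {p : Program} {s₁ s₂ s₃ : Memory} {t₁ t₂ : ℕ} (hx : s₁.reg x ≠ 0)
      (hp : Runs p s₁ s₂ t₁) (hl : Runs (.loop x p) s₂ s₃ t₂) :
      Runs (.loop x p) s₁ s₃ (t₁ + t₂ + 1)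
  | loop_zero {x : ℕ} {p : Program} {s : Memory} (hx : s.reg x = 0) : Runs (.loop x p) s s 1

/-- The bit length of a sequence of numbers written in binary, with one separator per number. -/
def bitLength (l : List ℕ) : ℕ :=
  (l.map fun n => Nat.size n + 1).sum

/-- `f` is computed by a program whose number of steps, including one step for handing over each
number of the output, is bounded by a polynomial in the bit length of the encoded argument. -/
def PolyTimeComputable {α β : Type*} (encα : α → List ℕ) (encβ : β → List ℕ) (f : α → β) : Prop :=
  ∃ (p : Program) (P : Polynomial ℕ), ∀ a : α, ∃ (s : Memory) (t : ℕ),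
    Runs p (Memory.init (encα a)) s t ∧ s.output = encβ (f a) ∧
    t + s.output.length ≤ P.eval (bitLength (encα a))

/-- `φ = (√5 - 1) / 2`, the inverse of the golden ratio. -/
noncomputable def phi : ℝ := (Real.sqrt 5 - 1) / 2

end MaxSat

namespace MaxSat

/-! ### The golden ratio -/

/-! Write δ = (2 - 3φ)/2. The clauses are split in two (`Separates`). The kept ones, which form F',
are matched to distinct variables that occur in kept clauses only, so all of them can be satisfied
without influence on the rest. The variables of the remaining clauses are matched to distinct
remaining clauses that contain them. For such a matched family without conflicting unit clauses,
some assignment satisfies weight at least φ times the total plus δ per variable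
(`exists_assignment_of_matching`). Gluing the two assignments gives the bound
(`Presents.exists_subformula`).

The matched case is probabilistic and rests on φ² = 1 - φ. Let U be the set of variables with a unit
clause. Typically a variable of U makes its unit literal true with probability φ, and any other
variable is a fair coin. A clause with a unit literal then holds with probability at least φ. A
clause with two negated unit literals of independent variables holds with probability at least 1 -
φ² = φ. A clause with a variable outside U has a second literal and holds with probability at least
1 - φ/2 = φ + δ, so it can pay δ for the variable outside U that is matched to it. Since weights are
at least 1, a surplus in probability is a surplus in weight.

Variables of U are paid for by correlating throws. Negated pairs form a graph on part of U, which is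
spanned by stars (`exists_star_forest`). A centre and its leaf are correlated so that their clause
has surplus 2δ and pays for both, while suitably coloured adjacent leaves still give φ. A variable
of U outside this graph is treated in one of three ways. If it is never the chosen second literal,
negated, of a clause with a variable outside U, it is fixed and paid by its unit clause. If it is in
a chosen second literal of such a clause that is matched to no variable outside U, that clause pays.
Otherwise it is correlated with a variable z outside U so that the clause matched to z pays for
both.

The split is found by an auction. Each unmatched variable takes its cheapest clause, evicts the
present owner and raises the price by 1. A matched clause then costs at most 1 more than any other
clause of its variable (`IsPriced`). With m clauses, some price between 1 and m + 1 does not occur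
at the end, and the clauses above this gap are kept (`separates_of_isPriced`). Prices are capped, so
the number of rounds is polynomial. The remaining work implements the auction on the random access
machine and counts steps (`halts_separate`). -/

lemma phi_sq : phi ^ 2 = 1 - phi := by
  have h : Real.sqrt 5 ^ 2 = 5 := Real.sq_sqrt (by norm_num)
  unfold phi; nlinarith

lemma phi_cube : phi ^ 3 = 2 * phi - 1 := by
  have := phi_sq; linear_combination (phi + -1) * this

lemma phi_fourth : phi ^ 4 = 2 - 3 * phi := by
  have := phi_sq; linear_combination (phi ^ 2 - phi + 2) * this

lemma phi_gt : 0.618 < phi := by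
  have : (2.236 : ℝ) < Real.sqrt 5 := by
    apply Real.lt_sqrt_of_sq_lt; norm_num
  unfold phi; linarith

lemma phi_lt : phi < 0.6181 := by
  have : Real.sqrt 5 < (2.2362 : ℝ) := by
    rw [Real.sqrt_lt' (by norm_num)]; norm_num
  unfold phi; linarith

/-! ### A die and independent throws of it -/

/-- The outcomes of a die. -/
abbrev Die := Fin 5 × Bool

/-- The probabilities of the outcomes of the die. -/
noncomputable def dieProb (o : Die) : ℝ :=
  -- The five faces are the atoms of the events {2,3,4}, {0,1,2}, {0,1,3} used by the rules below,
  -- each of which has probability 2φ³ + φ⁴ = φ. The factor 1/2 belongs to the additional fair bit.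
  ![phi ^ 3, phi ^ 4, phi ^ 3, phi ^ 3, phi ^ 4] o.1 / 2

/-- The probability that one throw of the die has the property `E`. -/
noncomputable def dieMeas (E : Die → Bool) : ℝ :=
  ∑ o, dieProb o * if E o then 1 else 0

lemma dieMeas_eq (E : Die → Bool) : dieMeas E =
    (phi ^ 3 * ((if E (0, true) then 1 else 0) + if E (0, false) then 1 else 0)
    + phi ^ 4 * ((if E (1, true) then 1 else 0) + if E (1, false) then 1 else 0)
    + phi ^ 3 * ((if E (2, true) then 1 else 0) + if E (2, false) then 1 else 0)
    + phi ^ 3 * ((if E (3, true) then 1 else 0) + if E (3, false) then 1 else 0)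
    + phi ^ 4 * ((if E (4, true) then 1 else 0) + if E (4, false) then 1 else 0)) / 2 := by
  simp only [dieMeas, dieProb, Fintype.sum_prod_type, Fin.sum_univ_five, Fintype.sum_bool]
  simp [-mul_ite]
  ring

lemma dieMeas_true : dieMeas (fun _ => true) = 1 := by
  rw [dieMeas_eq]; simp [phi_cube, phi_fourth]; ring

lemma sum_dieProb : ∑ o, dieProb o = 1 := by
  simpa [dieMeas] using dieMeas_true

lemma dieProb_nonneg (o : Die) : 0 ≤ dieProb o := by
  have := phi_gt
  obtain ⟨i, b⟩ := o
  unfold dieProb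
  fin_cases i <;> simp <;> positivity

section Throws

variable {V : Type*} [Fintype V]

/-- The probability of the outcome `ω` of independent throws, one for each `v : V`. -/
noncomputable def throwProb (ω : V → Die) : ℝ := ∏ v, dieProb (ω v)

lemma throwProb_nonneg (ω : V → Die) : 0 ≤ throwProb ω :=
  Finset.prod_nonneg fun _ _ => dieProb_nonneg _

variable [DecidableEq V]

/-- The probability of the event `E` for independent throws, one for each `v : V`. -/
noncomputable def throwMeas (E : (V → Die) → Bool) : ℝ :=
  ∑ ω, throwProb ω * if E ω then 1 else 0

/-- Independence of the throws: expanding a product of sums shows that expectations of functions of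
separate throws multiply. Indicators of one or two coordinates are the only cases needed. -/
lemma sum_throwProb_mul_prod (g : V → Die → ℝ) :
    ∑ ω : V → Die, throwProb ω * ∏ v, g v (ω v) = ∏ v, ∑ o, dieProb o * g v o := by
  rw [Finset.prod_univ_sum]
  simp [throwProb, Finset.prod_mul_distrib]

lemma sum_throwProb : ∑ ω : V → Die, throwProb ω = 1 := by
  have := sum_throwProb_mul_prod (V := V) (fun _ _ => 1)
  simpa [sum_dieProb] using this

lemma throwMeas_single (a : V) (E : Die → Bool) :
    throwMeas (fun ω : V → Die => E (ω a)) = dieMeas E := by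
  have := sum_throwProb_mul_prod (V := V)
    (fun v o => if v = a then (if E o then 1 else 0) else 1)
  simp only [Finset.prod_ite_eq', Finset.mem_univ, if_true] at this
  rw [throwMeas, this, Finset.prod_eq_single a]
  · simp [dieMeas]
  · intro b _ hb; simp [hb, sum_dieProb]
  · simp

lemma throwMeas_pair {a b : V} (hab : a ≠ b) (E E' : Die → Bool) :
    throwMeas (fun ω : V → Die => E (ω a) && E' (ω b)) = dieMeas E * dieMeas E' := by
  have := sum_throwProb_mul_prod (V := V)
    (fun v o => (if v = a then (if E o then 1 else 0) else 1) *
      (if v = b then (if E' o then 1 else 0) else 1))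
  simp only [Finset.prod_mul_distrib, Finset.prod_ite_eq', Finset.mem_univ, if_true] at this
  have h2 : ∀ v, (∑ o, dieProb o * ((if v = a then (if E o then (1 : ℝ) else 0) else 1) *
      (if v = b then (if E' o then 1 else 0) else 1))) =
      (if v = a then dieMeas E else 1) * (if v = b then dieMeas E' else 1) := by
    intro v
    by_cases h1 : v = a
    · have : v ≠ b := h1 ▸ hab
      simp [h1, hab, dieMeas]
    · by_cases h3 : v = b
      · simp [h3, hab.symm, dieMeas]
      · simp [h1, h3, sum_dieProb]
  simp only [h2, Finset.prod_mul_distrib, Finset.prod_ite_eq', Finset.mem_univ, if_true] at this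
  rw [← this, throwMeas]
  refine Finset.sum_congr rfl fun ω _ => ?_
  cases E (ω a) <;> cases E' (ω b) <;> simp

lemma throwMeas_mono {E E' : (V → Die) → Bool} (h : ∀ ω, E ω = true → E' ω = true) :
    throwMeas E ≤ throwMeas E' := by
  refine Finset.sum_le_sum fun ω _ => mul_le_mul_of_nonneg_left ?_ (throwProb_nonneg ω)
  by_cases h1 : E ω = true
  · simp [h1, h ω h1]
  · rw [if_neg h1]; split_ifs <;> norm_num

lemma throwMeas_not (E : (V → Die) → Bool) : throwMeas (fun ω => !E ω) = 1 - throwMeas E := by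
  rw [eq_sub_iff_add_eq, throwMeas, throwMeas, ← Finset.sum_add_distrib]
  refine Eq.trans ?_ (sum_throwProb (V := V))
  refine Finset.sum_congr rfl fun ω _ => ?_
  cases E ω <;> simp

end Throws

/-! ### Star forests -/

/-- A graph without isolated vertices is spanned by disjoint stars, such that the leaves of each
star can be coloured properly with two colours. -/
lemma exists_star_forest {V : Type*} [DecidableEq V] (Adj : V → V → Prop)
    (symm : ∀ x y, Adj x y → Adj y x) (irrefl : ∀ x, ¬ Adj x x) (S : Finset V)
    (hS : ∀ x ∈ S, ∃ y ∈ S, Adj x y) :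
    ∃ (l : V → V) (b : V → Bool),
      (∀ x ∈ S, l x ∈ S ∧ l (l x) = l x) ∧
      (∀ x ∈ S, l x ≠ x → Adj x (l x)) ∧
      (∀ x ∈ S, l x = x → ∃ y ∈ S, y ≠ x ∧ l y = x) ∧
      (∀ x ∈ S, ∀ y ∈ S, l x ≠ x → l y ≠ y → Adj x y → l x = l y → b x ≠ b y) := by
  classical
  induction S using Finset.strongInduction with
  | H S ih =>
  rcases S.eq_empty_or_nonempty with rfl | ⟨u, hu⟩
  · exact ⟨id, fun _ => true, by simp, by simp, by simp, by simp⟩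
  obtain ⟨v, hv, huv⟩ := hS u hu
  have huv' : u ≠ v := fun h => irrefl u (h ▸ huv)
  -- `I` consists of the vertices that become isolated when `u` and `v` are deleted. They are
  -- pairwise non-adjacent, and removing them together with `u` and `v` leaves a graph to which
  -- induction applies.
  set I := S.filter fun x => x ≠ u ∧ x ≠ v ∧ ∀ y ∈ S, Adj x y → y = u ∨ y = v with hI
  have hIuv : ∀ x ∈ I, x ∈ S ∧ x ≠ u ∧ x ≠ v ∧ (Adj x u ∨ Adj x v) := by
    intro x hx
    obtain ⟨hxS, h1, h2, h3⟩ := by simpa [hI] using hx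
    refine ⟨hxS, h1, h2, ?_⟩
    obtain ⟨y, hy, hxy⟩ := hS x hxS
    rcases h3 y hy hxy with rfl | rfl <;> simp [hxy]
  have hII : ∀ x ∈ I, ∀ y ∈ I, ¬ Adj x y := by
    intro x hx y hy hxy
    obtain ⟨hxS, h1, h2, h3⟩ := by simpa [hI] using hx
    obtain ⟨hyS, h4, h5, _⟩ := hIuv y hy
    rcases h3 y hyS hxy with h | h <;> contradiction
  set S' := S.filter fun x => x ≠ u ∧ x ≠ v ∧ x ∉ I with hS'
  have hS'mem : ∀ x, x ∈ S' ↔ x ∈ S ∧ x ≠ u ∧ x ≠ v ∧ x ∉ I := by simp [hS']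
  have hSI : ∀ x ∈ S, x ∈ S' ∨ x = u ∨ x = v ∨ x ∈ I := by
    intro x hx; rw [hS'mem]; tauto
  obtain ⟨l, b, hl1, hl2, hl3, hl4⟩ := ih S' (by
      refine Finset.ssubset_iff_subset_ne.2 ⟨Finset.filter_subset _ _, fun h => ?_⟩
      have := (hS'mem u).1 (by rw [h]; exact hu)
      exact this.2.1 rfl) (by
      intro x hx
      obtain ⟨h1, h2, h3, h4⟩ := (hS'mem x).1 hx
      by_contra! hcon
      refine h4 ?_
      simp only [hI, Finset.mem_filter]
      refine ⟨h1, h2, h3, fun y hy hxy => ?_⟩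
      by_contra! hne
      refine hcon y ((hS'mem y).2 ⟨hy, hne.1, hne.2, fun hyI => ?_⟩) hxy
      obtain ⟨_, _, _, h8⟩ := by simpa [hI] using hyI
      rcases h8 x h1 (symm _ _ hxy) with h | h <;> contradiction)
  -- a star forest of the vertices outside `S'`
  obtain ⟨l', b', h1, h2, h3, h4⟩ : ∃ (l' : V → V) (b' : V → Bool),
      (∀ x, x = u ∨ x = v ∨ x ∈ I → (l' x = u ∨ l' x = v ) ∧ l' (l' x) = l' x) ∧
      (∀ x, x = u ∨ x = v ∨ x ∈ I → l' x ≠ x → Adj x (l' x)) ∧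
      (∀ x, x = u ∨ x = v ∨ x ∈ I → l' x = x → ∃ y, (y = u ∨ y = v ∨ y ∈ I) ∧ y ≠ x ∧ l' y = x) ∧
      (∀ x, x = u ∨ x = v ∨ x ∈ I → ∀ y, y = u ∨ y = v ∨ y ∈ I → l' x ≠ x → l' y ≠ y → Adj x y →
        l' x = l' y → b' x ≠ b' y) := by
    -- A single star with centre `u`: adjacent leaves can only be `v` and a vertex of the
    -- independent set `I`, so giving `v` a colour of its own is a proper colouring.
    have star : ∀ u v : V, u ≠ v → Adj u v → (∀ x ∈ I, x ≠ u ∧ x ≠ v ∧ Adj x u) →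
        ∃ (l' : V → V) (b' : V → Bool),
      (∀ x, x = u ∨ x = v ∨ x ∈ I → (l' x = u ∨ l' x = v ) ∧ l' (l' x) = l' x) ∧
      (∀ x, x = u ∨ x = v ∨ x ∈ I → l' x ≠ x → Adj x (l' x)) ∧
      (∀ x, x = u ∨ x = v ∨ x ∈ I → l' x = x → ∃ y, (y = u ∨ y = v ∨ y ∈ I) ∧ y ≠ x ∧ l' y = x) ∧
      (∀ x, x = u ∨ x = v ∨ x ∈ I → ∀ y, y = u ∨ y = v ∨ y ∈ I → l' x ≠ x → l' y ≠ y → Adj x y →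
        l' x = l' y → b' x ≠ b' y) := by
      intro u v huv' huv hIu
      refine ⟨fun _ => u, fun x => decide (x = v), by simp, ?_, ?_, ?_⟩
      · rintro x (rfl | rfl | hx) h
        · exact absurd rfl h
        · exact symm _ _ huv
        · exact (hIu x hx).2.2
      · intro x _ (hx : u = x)
        exact ⟨v, by simp, hx ▸ huv'.symm, hx⟩
      · rintro x hx y hy hxu hyu hxy - heq
        have hx' : x = v ∨ x ∈ I := by tauto
        have hy' : y = v ∨ y ∈ I := by tauto
        rcases hx' with rfl | hx' <;> rcases hy' with rfl | hy'
        · exact irrefl _ hxy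
        · simp [(hIu y hy').2.1] at heq
        · simp [(hIu x hx').2.1] at heq
        · exact hII _ hx' _ hy' hxy
    by_cases hu' : ∀ x ∈ I, Adj x u
    · exact star u v huv' huv fun x hx =>
        ⟨(hIuv x hx).2.1, (hIuv x hx).2.2.1, hu' x hx⟩
    by_cases hv' : ∀ x ∈ I, Adj x v
    · obtain ⟨l', b', h1, h2, h3, h4⟩ := star v u huv'.symm (symm _ _ huv) fun x hx =>
        ⟨(hIuv x hx).2.2.1, (hIuv x hx).2.1, hv' x hx⟩
      have e : ∀ x, (x = u ∨ x = v ∨ x ∈ I) ↔ (x = v ∨ x = u ∨ x ∈ I) := by intro x; tauto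
      refine ⟨l', b', ?_, ?_, ?_, ?_⟩
      · intro x hx; rw [or_comm]; exact h1 x ((e x).1 hx)
      · intro x hx; exact h2 x ((e x).1 hx)
      · intro x hx hxx
        obtain ⟨y, hy, hh⟩ := h3 x ((e x).1 hx) hxx
        exact ⟨y, (e y).2 hy, hh⟩
      · intro x hx y hy; exact h4 x ((e x).1 hx) y ((e y).1 hy)
    -- Now some `a ∈ I` sees only `v` and some `c ∈ I` sees only `u`. Hence two stars with centres
    -- `u` and `v` both have leaves, and all leaves lie in the independent set `I`.
    push Not at hu' hv'
    obtain ⟨a, ha, hau⟩ := hu'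
    obtain ⟨c, hc, hcv⟩ := hv'
    have hcu : Adj c u := (hIuv c hc).2.2.2.resolve_right hcv
    have hl : ∀ x ∈ I, x ≠ u ∧ x ≠ v := fun x hx => ⟨(hIuv x hx).2.1, (hIuv x hx).2.2.1⟩
    refine ⟨fun x => if x = u then u else if x = v then v else if Adj x u then u else v,
      fun _ => true, ?_, ?_, ?_, ?_⟩
    · intro x _
      by_cases e1 : x = u
      · simp [e1]
      by_cases e2 : x = v
      · simp [e2, huv'.symm]
      by_cases e3 : Adj x u <;> simp [e1, e2, e3, huv'.symm]
    · rintro x (rfl | rfl | hx) h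
      · simp at h
      · simp [huv'.symm] at h
      · simp only [(hl x hx).1, (hl x hx).2, if_false]
        split_ifs with h3
        · exact h3
        · exact (hIuv x hx).2.2.2.resolve_left h3
    · rintro x (rfl | rfl | hx) h
      · exact ⟨c, by simp [hc], (hl c hc).1, by simp [hl c hc, hcu]⟩
      · exact ⟨a, by simp [ha], (hl a ha).2, by simp [hl a ha, hau]⟩
      · exfalso
        simp only [(hl x hx).1, (hl x hx).2, if_false] at h
        split_ifs at h
        · exact (hl x hx).1 h.symm
        · exact (hl x hx).2 h.symm
    · intro x hx y hy hxl hyl hxy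
      have hx' : x ∈ I := by
        rcases hx with rfl | rfl | h
        · simp at hxl
        · simp [huv'.symm] at hxl
        · exact h
      have hy' : y ∈ I := by
        rcases hy with rfl | rfl | h
        · simp at hyl
        · simp [huv'.symm] at hyl
        · exact h
      exact absurd hxy (hII _ hx' _ hy')
  have huS' : u ∉ S' := fun h => ((hS'mem u).1 h).2.1 rfl
  have hvS' : v ∉ S' := fun h => ((hS'mem v).1 h).2.2.1 rfl
  have hIS' : ∀ x, x = u ∨ x = v ∨ x ∈ I → x ∉ S' ∧ x ∈ S := by
    rintro x (rfl | rfl | h)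
    · exact ⟨huS', hu⟩
    · exact ⟨hvS', hv⟩
    · exact ⟨fun hx => ((hS'mem x).1 hx).2.2.2 h, (hIuv x h).1⟩
  have hsub : ∀ x ∈ S', x ∈ S := fun x hx => ((hS'mem x).1 hx).1
  have hl' : ∀ x, x = u ∨ x = v ∨ x ∈ I → l' x = u ∨ l' x = v ∨ l' x ∈ I := by
    intro x hx; rcases (h1 x hx).1 with h | h <;> simp [h]
  refine ⟨fun x => if x ∈ S' then l x else l' x, fun x => if x ∈ S' then b x else b' x,
    ?_, ?_, ?_, ?_⟩
  · intro x hx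
    rcases hSI x hx with h | h
    · simp [h, hl1 x h, hsub]
    · simp [(hIS' x h).1, (hIS' _ (hl' x h)).1, h1 x h, (hIS' _ (hl' x h)).2]
  · intro x hx
    rcases hSI x hx with h | h
    · simpa [h] using hl2 x h
    · simpa [(hIS' x h).1] using h2 x h
  · intro x hx
    rcases hSI x hx with h | h
    · simp only [h, if_true]
      intro hx
      obtain ⟨y, hy, hyx, hyl⟩ := hl3 x h hx
      exact ⟨y, hsub y hy, hyx, by simp [hy, hyl]⟩
    · simp only [(hIS' x h).1, if_false]
      intro hx
      obtain ⟨y, hy, hyx, hyl⟩ := h3 x h hx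
      exact ⟨y, (hIS' y hy).2, hyx, by simp [(hIS' y hy).1, hyl]⟩
  · intro x hx y hy
    rcases hSI x hx with h | h <;> rcases hSI y hy with h' | h'
    · simpa [h, h'] using hl4 x h y h'
    · simp only [h, (hIS' y h').1, if_true, if_false]
      intro _ _ _ heq
      exact absurd (heq ▸ (hl1 x h).1) (hIS' _ (hl' y h')).1
    · simp only [h', (hIS' x h).1, if_true, if_false]
      intro _ _ _ heq
      exact absurd (heq ▸ (hl1 y h').1) (hIS' _ (hl' x h)).1
    · simpa [(hIS' x h).1, (hIS' y h').1] using h4 x h y h'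

/-! ### Random assignments -/

section Random

variable {V : Type*} [Fintype V] [DecidableEq V]

/-- The probability that a clause is satisfied, if the value of the variable `v` is `A v` of the
throw of the die of `l v`. -/
noncomputable def satProb (l : V → V) (A : V → Die → Bool) (c : Finset (V × Bool)) : ℝ :=
  throwMeas fun ω => decide (∃ v, (v, A v (ω (l v))) ∈ c)

lemma le_satProb_single (l : V → V) (A : V → Die → Bool) {c : Finset (V × Bool)} {a : V}
    {s : Bool} (ha : (a, s) ∈ c) : 1 - dieMeas (fun o => A a o != s) ≤ satProb l A c := by
  rw [← throwMeas_single (l a), ← throwMeas_not]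
  refine throwMeas_mono fun ω h => ?_
  simp at h
  simp only [decide_eq_true_eq]
  exact ⟨a, h ▸ ha⟩

lemma le_satProb (l : V → V) (A : V → Die → Bool) {c : Finset (V × Bool)} {a b : V}
    {s t : Bool} (ha : (a, s) ∈ c) (hb : (b, t) ∈ c) :
    1 - throwMeas (fun ω => (A a (ω (l a)) != s) && (A b (ω (l b)) != t)) ≤ satProb l A c := by
  rw [← throwMeas_not]
  refine throwMeas_mono fun ω h => ?_
  simp only [decide_eq_true_eq]
  by_cases h1 : A a (ω (l a)) = s
  · exact ⟨a, h1 ▸ ha⟩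
  · by_cases h2 : A b (ω (l b)) = t
    · exact ⟨b, h2 ▸ hb⟩
    · simp [h1, h2] at h

lemma le_satProb_of_ne (l : V → V) (A : V → Die → Bool) {c : Finset (V × Bool)} {a b : V}
    {s t : Bool} (ha : (a, s) ∈ c) (hb : (b, t) ∈ c) (hl : l a ≠ l b) :
    1 - dieMeas (fun o => A a o != s) * dieMeas (fun o => A b o != t) ≤ satProb l A c := by
  rw [← throwMeas_pair hl]
  exact le_satProb l A ha hb

lemma le_satProb_of_eq (l : V → V) (A : V → Die → Bool) {c : Finset (V × Bool)} {a b : V}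
    {s t : Bool} (ha : (a, s) ∈ c) (hb : (b, t) ∈ c) (hl : l a = l b) :
    1 - dieMeas (fun o => (A a o != s) && (A b o != t)) ≤ satProb l A c := by
  rw [← throwMeas_single (l b)]
  have := le_satProb l A ha hb
  rwa [hl] at this

/-- If every clause is satisfied with probability at least `φ`, and this by so much more that all
variables can be charged to the clauses, then some assignment is good. -/
lemma exists_assignment_of_charge {ι : Type*} [Fintype ι] [DecidableEq ι]
    (c : ι → Finset (V × Bool)) (w : ι → ℕ) (hw : ∀ i, 0 < w i)
    (l : V → V) (A : V → Die → Bool) (κ : V → ι)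
    (hκ : ∀ i, (2 - 3 * phi) / 2 * (Finset.univ.filter fun v => κ v = i).card ≤
      satProb l A (c i) - phi) :
    ∃ α : V → Bool, phi * ∑ i, (w i : ℝ) + (2 - 3 * phi) / 2 * Fintype.card V ≤
      ∑ i with ∃ v, (v, α v) ∈ c i, (w i : ℝ) := by
  have hδ : 0 ≤ (2 - 3 * phi) / 2 := by have := phi_lt; linarith
  -- The expected satisfied weight would also fall short if every assignment did.
  by_contra! hcon
  have h1 : ∑ i, (w i : ℝ) * satProb l A (c i) <
      phi * ∑ i, (w i : ℝ) + (2 - 3 * phi) / 2 * Fintype.card V := by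
    have e : ∑ i, (w i : ℝ) * satProb l A (c i) = ∑ ω : V → Die, throwProb ω *
        ∑ i with ∃ v, (v, A v (ω (l v))) ∈ c i, (w i : ℝ) := by
      simp only [satProb, throwMeas, Finset.mul_sum, Finset.sum_filter]
      rw [Finset.sum_comm]
      refine Finset.sum_congr rfl fun ω _ => Finset.sum_congr rfl fun i _ => ?_
      by_cases h : ∃ v, (v, A v (ω (l v))) ∈ c i <;> simp [h, mul_comm]
    rw [e]
    have e2 : phi * ∑ i, (w i : ℝ) + (2 - 3 * phi) / 2 * Fintype.card V =
        ∑ ω : V → Die, throwProb ω *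
          (phi * ∑ i, (w i : ℝ) + (2 - 3 * phi) / 2 * Fintype.card V) := by
      rw [← Finset.sum_mul, sum_throwProb, one_mul]
    rw [e2]
    have hpos : ∃ ω : V → Die, 0 < throwProb ω := by
      by_contra! h
      have := Finset.sum_nonpos (s := Finset.univ) fun ω _ => h ω
      rw [sum_throwProb] at this
      norm_num at this
    obtain ⟨ω₀, hω₀⟩ := hpos
    exact Finset.sum_lt_sum
      (fun ω _ => mul_le_mul_of_nonneg_left (hcon _).le (throwProb_nonneg ω))
      ⟨ω₀, Finset.mem_univ _, mul_lt_mul_of_pos_left (hcon _) hω₀⟩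
  have h2 : ∑ i, (2 - 3 * phi) / 2 * ((Finset.univ.filter fun v => κ v = i).card : ℝ) =
      (2 - 3 * phi) / 2 * Fintype.card V := by
    rw [← Finset.mul_sum, ← Nat.cast_sum, ← Finset.card_univ,
      Finset.card_eq_sum_card_fiberwise (s := Finset.univ) (t := Finset.univ) (f := κ) (by simp)]
  -- Integrality of the weights enters here: the surplus in probability is nonnegative, so
  -- multiplying it by a weight of at least 1 does not decrease it.
  have h3 : ∀ i, (2 - 3 * phi) / 2 * ((Finset.univ.filter fun v => κ v = i).card : ℝ) ≤
      (w i : ℝ) * satProb l A (c i) - phi * w i := by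
    intro i
    have h4 := hκ i
    have h5 : (1 : ℝ) ≤ w i := by exact_mod_cast hw i
    have h6 : 0 ≤ (2 - 3 * phi) / 2 * ((Finset.univ.filter fun v => κ v = i).card : ℝ) := by
      positivity
    nlinarith
  have h4 := Finset.sum_le_sum fun i (_ : i ∈ Finset.univ) => h3 i
  rw [h2, Finset.sum_sub_distrib, ← Finset.mul_sum] at h4
  linarith

end Random

/-! ### The assignment of a single variable as a function of the die -/

/-- The rule of a coin that shows `s` with probability `φ`. -/
def coinRule (s : Bool) (o : Die) : Bool := decide (2 ≤ o.1) == s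

/-- Two rules for the leaves of a star the centre of which follows `coinRule`. -/
def leafRule (b s : Bool) (o : Die) : Bool :=
  (if b then decide (o.1 = 0 ∨ o.1 = 1 ∨ o.1 = 2) else decide (o.1 = 0 ∨ o.1 = 1 ∨ o.1 = 3)) == s

/-- A fair coin that is correlated with `coinRule`. -/
def corrRule (s : Bool) (o : Die) : Bool :=
  (if o.1 = 0 then false else if o.1 = 2 then true else o.2) == s

lemma dieMeas_coinRule (s : Bool) : dieMeas (fun o => coinRule s o != !s) = phi := by
  rw [dieMeas_eq]; cases s <;> simp [coinRule, phi_cube, phi_fourth] <;> ring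

lemma dieMeas_coinRule' (s : Bool) : dieMeas (fun o => coinRule s o != s) = 1 - phi := by
  rw [dieMeas_eq]; cases s <;> simp [coinRule, phi_cube, phi_fourth] <;> ring

lemma dieMeas_leafRule (b s : Bool) : dieMeas (fun o => leafRule b s o != !s) = phi := by
  rw [dieMeas_eq]; cases s <;> cases b <;> simp [leafRule, phi_cube, phi_fourth] <;> ring

lemma dieMeas_leafRule' (b s : Bool) : dieMeas (fun o => leafRule b s o != s) = 1 - phi := by
  rw [dieMeas_eq]; cases s <;> cases b <;> simp [leafRule, phi_cube, phi_fourth] <;> ring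

lemma dieMeas_corrRule (s t : Bool) : dieMeas (fun o => corrRule s o != t) = 1 / 2 := by
  rw [dieMeas_eq]; cases s <;> cases t <;> simp [corrRule, phi_cube, phi_fourth] <;> ring

lemma dieMeas_fair (t : Bool) : dieMeas (fun o => o.2 != t) = 1 / 2 := by
  rw [dieMeas_eq]; cases t <;> simp [phi_cube, phi_fourth] <;> ring

lemma dieMeas_const (s : Bool) : dieMeas (fun _ => s != s) = 0 := by
  rw [dieMeas_eq]; simp

/-- Only the faces 3 and 4 with an unfavourable bit contribute, which gives (φ³ + φ⁴)/2. A clause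
with these two literals fails with probability (1 - φ)/2 instead of φ/2, and its surplus (1 - φ)/2
exceeds 2 - 3φ, enough for two variables. -/
lemma dieMeas_corrRule_coinRule (s t : Bool) :
    dieMeas (fun o => (corrRule s o != s) && (coinRule t o != !t)) = (1 - phi) / 2 := by
  rw [dieMeas_eq]; cases s <;> cases t <;> simp [corrRule, coinRule, phi_cube, phi_fourth] <;> ring

/-- The centre's event {2,3,4} meets the leaf's event in one face, of probability φ³. The clause of
both negated literals therefore holds with probability 2 - 2φ = φ + (2 - 3φ), which pays for centre
and leaf. -/
lemma dieMeas_coinRule_leafRule (s b t : Bool) :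
    dieMeas (fun o => (coinRule s o != !s) && (leafRule b t o != !t)) = 2 * phi - 1 := by
  rw [dieMeas_eq]
  cases s <;> cases t <;> cases b <;> simp [leafRule, coinRule, phi_cube] <;> ring

lemma dieMeas_leafRule_coinRule (s b t : Bool) :
    dieMeas (fun o => (leafRule b t o != !t) && (coinRule s o != !s)) = 2 * phi - 1 := by
  simp only [← dieMeas_coinRule_leafRule s b t, Bool.and_comm]

/-- The events {0,1,2} and {0,1,3} meet in {0,1}, of probability φ³ + φ⁴ = φ². Leaves of different
colours thus fail together as rarely as independent variables do; equal colours would give φ, hence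
the need for a proper colouring. -/
lemma dieMeas_leafRule_leafRule (s t : Bool) {b b' : Bool} (hb : b ≠ b') :
    dieMeas (fun o => (leafRule b s o != !s) && (leafRule b' t o != !t)) = 1 - phi := by
  rw [dieMeas_eq]
  cases s <;> cases t <;> cases b <;> cases b' <;> simp at hb <;>
    simp [leafRule, phi_cube, phi_fourth] <;> ring

/-- In every clause of a family without conflicting unit clauses, literals can be chosen such that
their variables behave in a prescribed way.  Here `U` are the variables of unit clauses, which are
`(x, σ x)`. -/
lemma exists_literals {V ι : Type*} [DecidableEq V]
    (c : ι → Finset (V × Bool)) (hne : ∀ i, (c i).Nonempty)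
    (m : V → ι) (hm : Function.Injective m) (hmem : ∀ v, ∃ b, (v, b) ∈ c (m v))
    (U : V → Prop) (σ : V → Bool) (hU : ∀ i x b, c i = {(x, b)} → U x ∧ b = σ x) :
    ∃ zl ol : ι → V × Bool, ∀ i,
      ((∃ z b, ¬ U z ∧ (z, b) ∈ c i) → zl i ∈ c i ∧ ol i ∈ c i ∧ zl i ≠ ol i ∧ ¬ U (zl i).1 ∧
        ∀ z, ¬ U z → m z = i → (zl i).1 = z) ∧
      ((¬ ∃ z b, ¬ U z ∧ (z, b) ∈ c i) → (¬ ∃ x, U x ∧ (x, σ x) ∈ c i) →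
        zl i ∈ c i ∧ ol i ∈ c i ∧ (zl i).1 ≠ (ol i).1 ∧ U (zl i).1 ∧ U (ol i).1 ∧
        (zl i).2 = !σ (zl i).1 ∧ (ol i).2 = !σ (ol i).1) := by
  have key : ∀ i, ∃ zl ol : V × Bool,
      ((∃ z b, ¬ U z ∧ (z, b) ∈ c i) → zl ∈ c i ∧ ol ∈ c i ∧ zl ≠ ol ∧ ¬ U zl.1 ∧
        ∀ z, ¬ U z → m z = i → zl.1 = z) ∧
      ((¬ ∃ z b, ¬ U z ∧ (z, b) ∈ c i) → (¬ ∃ x, U x ∧ (x, σ x) ∈ c i) →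
        zl ∈ c i ∧ ol ∈ c i ∧ zl.1 ≠ ol.1 ∧ U zl.1 ∧ U ol.1 ∧
        zl.2 = !σ zl.1 ∧ ol.2 = !σ ol.1) := by
    intro i
    -- A clause whose only literal is `a` is a unit clause, so `a` would be the unit literal of its
    -- variable.
    have other : ∀ a ∈ c i, (∀ x, U x → a ≠ (x, σ x)) → ∃ a' ∈ c i, a ≠ a' := by
      intro a ha haU
      by_contra! hcon
      have : c i = {a} := Finset.eq_singleton_iff_unique_mem.2 ⟨ha, fun y hy => (hcon y hy).symm⟩
      obtain ⟨h1, h2⟩ := hU i a.1 a.2 this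
      exact haU a.1 h1 (by rw [← h2])
    by_cases hM : ∃ z b, ¬ U z ∧ (z, b) ∈ c i
    -- If the clause is matched to a variable outside `U`, which is unique by injectivity of `m`,
    -- that variable is preferred as first literal.
    · obtain ⟨z, b, hz, hzb, hown⟩ : ∃ z b, ¬ U z ∧ (z, b) ∈ c i ∧ ∀ z', ¬ U z' → m z' = i → z = z' := by
        by_cases ho : ∃ z, ¬ U z ∧ m z = i
        · obtain ⟨z, hz, rfl⟩ := ho
          obtain ⟨b, hb⟩ := hmem z
          exact ⟨z, b, hz, hb, fun z' _ h => (hm h).symm⟩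
        · obtain ⟨z, b, hz, hb⟩ := hM
          exact ⟨z, b, hz, hb, fun z' h1 h2 => absurd ⟨z', h1, h2⟩ ho⟩
      obtain ⟨a, ha, hza⟩ := other (z, b) hzb fun x hx h => hz ((show z = x from (Prod.ext_iff.1 h).1) ▸ hx)
      exact ⟨(z, b), a, fun _ => ⟨hzb, ha, hza, hz, hown⟩, fun h => absurd hM h⟩
    by_cases hK : ∃ x, U x ∧ (x, σ x) ∈ c i
    · obtain ⟨a, ha⟩ := hne i
      exact ⟨a, a, fun h => absurd h hM, fun _ h => absurd hK h⟩
    · push Not at hM hK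
      have hneg : ∀ a ∈ c i, U a.1 ∧ a.2 = !σ a.1 := by
        intro a ha
        have h1 : U a.1 := by
          by_contra h
          exact hM a.1 a.2 h ha
        refine ⟨h1, ?_⟩
        have h2 := hK a.1 h1
        by_contra h3
        have : a.2 = σ a.1 := by simpa using h3
        exact h2 (this ▸ ha)
      obtain ⟨a, ha⟩ := hne i
      obtain ⟨a', ha', haa⟩ := other a ha fun x hx h => hK x hx (h ▸ ha)
      refine ⟨a, a', fun ⟨z, b, h⟩ => absurd h.2 (hM z b h.1), fun _ _ => ⟨ha, ha', fun h => haa ?_,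
        (hneg a ha).1, (hneg a' ha').1, (hneg a ha).2, (hneg a' ha').2⟩⟩
      exact Prod.ext h (by rw [(hneg a ha).2, (hneg a' ha').2, h])
  choose zl ol h using key
  exact ⟨zl, ol, h⟩

set_option maxHeartbeats 4000000 in
/-- If the variables can be matched to clauses of a family without conflicting unit clauses, then
some assignment satisfies more than the share `φ` of the total weight. -/
theorem exists_assignment_of_matching {V ι : Type*} [Fintype V] [DecidableEq V] [Fintype ι]
    [DecidableEq ι] (c : ι → Finset (V × Bool)) (w : ι → ℕ) (hw : ∀ i, 0 < w i)
    (hne : ∀ i, (c i).Nonempty)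
    (ucf : ∀ x i j, ¬ (c i = {(x, true)} ∧ c j = {(x, false)}))
    (m : V → ι) (hm : Function.Injective m) (hmem : ∀ v, ∃ b, (v, b) ∈ c (m v)) :
    ∃ α : V → Bool, phi * ∑ i, (w i : ℝ) + (2 - 3 * phi) / 2 * Fintype.card V ≤
      ∑ i with ∃ v, (v, α v) ∈ c i, (w i : ℝ) := by
  classical
  have hp1 := phi_gt
  have hp2 := phi_lt
  have hp3 := phi_sq
  -- the variables of unit clauses
  obtain ⟨U, σ, hUdef, hUσ⟩ : ∃ (U : V → Prop) (σ : V → Bool), (∀ x, U x → ∃ i, c i = {(x, σ x)}) ∧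
      ∀ i x b, c i = {(x, b)} → U x ∧ b = σ x := by
    refine ⟨fun x => ∃ i b, c i = {(x, b)}, fun x => decide (∃ i, c i = {(x, true)}), ?_, ?_⟩
    · rintro x ⟨i, b, hi⟩
      by_cases h : ∃ i, c i = {(x, true)}
      · simp [h]
      · cases b
        · exact ⟨i, by simp [h, hi]⟩
        · exact absurd ⟨i, hi⟩ h
    · intro i x b hi
      refine ⟨⟨i, b, hi⟩, ?_⟩
      cases b
      · have : ¬ ∃ i, c i = {(x, true)} := fun ⟨j, hj⟩ => ucf x j i ⟨hj, hi⟩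
        simp [this]
      · have : ∃ i, c i = {(x, true)} := ⟨i, hi⟩
        simp [this]
  obtain ⟨zl, ol, hlit⟩ := exists_literals c hne m hm hmem U σ hUσ
  set M : ι → Prop := fun i => ∃ z b, ¬ U z ∧ (z, b) ∈ c i with hMdef
  set K : ι → Prop := fun i => ∃ x, U x ∧ (x, σ x) ∈ c i with hKdef
  have hM := fun i => (hlit i).1
  have hB := fun i => (hlit i).2
  have hmM : ∀ z, ¬ U z → M (m z) := fun z hz => ⟨z, (hmem z).choose, hz, (hmem z).choose_spec⟩
  -- the graph of the negative clauses
  set Adj : V → V → Prop := fun x y => ∃ i, ¬ M i ∧ ¬ K i ∧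
    (((zl i).1 = x ∧ (ol i).1 = y) ∨ ((zl i).1 = y ∧ (ol i).1 = x)) with hAdj
  set S : Finset V := Finset.univ.filter fun x => ∃ y, Adj x y with hSdef
  have hAsymm : ∀ x y, Adj x y → Adj y x := by
    rintro x y ⟨i, h1, h2, h3⟩
    exact ⟨i, h1, h2, h3.symm⟩
  obtain ⟨l, b, hl1, hl2, hl3, hl4⟩ := exists_star_forest Adj hAsymm (by
      rintro x ⟨i, h1, h2, ⟨rfl, h⟩ | ⟨rfl, h⟩⟩
      · exact (hB i h1 h2).2.2.1 h.symm
      · exact (hB i h1 h2).2.2.1 h.symm) S (by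
      intro x hx
      obtain ⟨y, hy⟩ := by simpa [hSdef] using hx
      exact ⟨y, by simpa [hSdef] using ⟨x, hAsymm _ _ hy⟩, hy⟩)
  have hSU : ∀ x ∈ S, U x := by
    intro x hx
    obtain ⟨y, i, h1, h2, ⟨rfl, h⟩ | ⟨h, rfl⟩⟩ := by simpa [hSdef] using hx
    · exact (hB i h1 h2).2.2.2.1
    · exact (hB i h1 h2).2.2.2.2.1
  -- the kinds of variables of unit clauses outside this graph
  set Uc : V → Prop := fun x => U x ∧ x ∉ S ∧ ∀ i, M i → ol i ≠ (x, !σ x) with hUc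
  -- Three ways to pay for x. In `Uc`, x may be fixed to `σ x`, because no clause of kind `M` relies
  -- on its negation. In `Ub`, some clause of kind `M` is matched to no variable outside `U` and has
  -- its surplus free for x. The variables of `Up` must share a clause with the variable outside `U`
  -- to which it is matched.
  set Ub : V → Prop := fun x => ∃ i, M i ∧ (ol i).1 = x ∧ ∀ z, ¬ U z → m z ≠ i with hUb
  set Up : V → Prop := fun x => U x ∧ x ∉ S ∧ ¬ Uc x ∧ ¬ Ub x with hUp
  obtain ⟨e, he⟩ : ∃ e : V → ι, ∀ x, Up x → M (e x) ∧ ol (e x) = (x, !σ x) := by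
    have : ∀ x, ∃ i, Up x → M i ∧ ol i = (x, !σ x) := by
      intro x
      by_cases hx : Up x
      · have := hx.2.2.1
        simp only [hUc, not_and, not_forall, not_not] at this
        obtain ⟨i, h1, h2⟩ := this hx.1 hx.2.1
        exact ⟨i, fun _ => ⟨h1, h2⟩⟩
      · exact ⟨m x, fun h => absurd h hx⟩
    choose e he using this
    exact ⟨e, he⟩
  have hown : ∀ x i, Up x → M i → (ol i).1 = x → ¬ U (zl i).1 ∧ m (zl i).1 = i := by
    intro x i hx hi hol
    have := hx.2.2.2
    simp only [hUb, not_exists, not_and, not_forall, not_not] at this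
    obtain ⟨z, hz, hzi⟩ := this i hi hol
    exact ⟨(hM i hi).2.2.2.1, by rw [(hM i hi).2.2.2.2 z hz hzi, hzi]⟩
  -- `Q` collects the partners: such a z reads the die of the variable x of `Up` for which its own
  -- clause `m z` was chosen as `e x`.
  set Q : V → Prop := fun z => ¬ U z ∧ Up (ol (m z)).1 ∧ e (ol (m z)).1 = m z with hQ
  -- the rules
  set A : V → Die → Bool := fun v =>
    if U v then
      if v ∈ S then
        if l v = v then coinRule (σ v) else leafRule (b v) (σ v)
      else if Uc v then fun _ => σ v else coinRule (σ v)
    else if Q v then corrRule (zl (m v)).2 else fun o => o.2 with hA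
  set ld : V → V := fun v =>
    if U v then if v ∈ S then l v else v else if Q v then (ol (m v)).1 else v with hld
  have hA1 : ∀ z s, ¬ U z → dieMeas (fun o => A z o != s) = 1 / 2 := by
    intro z s hz
    by_cases hq : Q z
    · simpa [hA, hz, hq] using dieMeas_corrRule _ s
    · simpa [hA, hz, hq] using dieMeas_fair s
  have hA2 : ∀ x, U x → ¬ Uc x → dieMeas (fun o => A x o != !σ x) = phi := by
    intro x hx hc
    by_cases hS : x ∈ S
    · by_cases hl : l x = x
      · simpa [hA, hx, hS, hl] using dieMeas_coinRule (σ x)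
      · simpa [hA, hx, hS, hl] using dieMeas_leafRule (b x) (σ x)
    · simpa [hA, hx, hS, hc] using dieMeas_coinRule (σ x)
  have hA3 : ∀ x, U x → ¬ Uc x → dieMeas (fun o => A x o != σ x) = 1 - phi := by
    intro x hx hc
    by_cases hS : x ∈ S
    · by_cases hl : l x = x
      · simpa [hA, hx, hS, hl] using dieMeas_coinRule' (σ x)
      · simpa [hA, hx, hS, hl] using dieMeas_leafRule' (b x) (σ x)
    · simpa [hA, hx, hS, hc] using dieMeas_coinRule' (σ x)
  have hA4 : ∀ x, Uc x → dieMeas (fun o => A x o != σ x) = 0 := by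
    intro x hc
    simpa [hA, hc.1, hc.2.1, hc] using dieMeas_const (σ x)
  -- Only the negated literal of a fixed variable is surely false. Every other literal fails with
  -- probability 0, 1 - φ, 1/2 or φ.
  have hA5 : ∀ a : V × Bool, ¬ (Uc a.1 ∧ a.2 = !σ a.1) → dieMeas (fun o => A a.1 o != a.2) ≤ phi := by
    rintro ⟨x, s⟩ hs
    by_cases hx : U x
    · by_cases hc : Uc x
      · have : s = σ x := by
          have h : s ≠ !σ x := fun h => hs ⟨hc, h⟩
          simpa using h
        rw [this, hA4 x hc]; linarith
      · by_cases h : s = σ x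
        · rw [h, hA3 x hx hc]; linarith
        · have : s = !σ x := Bool.eq_not_of_ne h
          rw [this, hA2 x hx hc]
    · rw [hA1 x s hx]; linarith
  -- the leaders
  have hldS : ∀ x ∈ S, ld x = l x := fun x hx => by simp [hld, hSU x hx, hx]
  have hldU : ∀ x, U x → x ∉ S → ld x = x := fun x hx h => by simp [hld, hx, h]
  have hldQ : ∀ z, Q z → ld z = (ol (m z)).1 := fun z hz => by simp [hld, hz.1, hz]
  have hldN : ∀ z, ¬ U z → ¬ Q z → ld z = z := fun z hz h => by simp [hld, hz, h]
  have hldUU : ∀ x, U x → U (ld x) := by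
    intro x hx
    by_cases h : x ∈ S
    · rw [hldS x h]; exact hSU _ (hl1 x h).1
    · rw [hldU x hx h]; exact hx
  -- clauses with a variable that has no unit clause
  have hPM : ∀ i, M i → phi + (2 - 3 * phi) / 2 ≤ satProb ld A (c i) ∧
      ((∃ x, Up x ∧ e x = i) → phi + (2 - 3 * phi) ≤ satProb ld A (c i)) := by
    intro i hi
    obtain ⟨h1, h2, h3, h4, h5⟩ := hM i hi
    by_cases hv : (zl i).1 = (ol i).1
    · have h6 : 1 ≤ satProb ld A (c i) := by
        have h7 := le_satProb_of_eq ld A (a := (zl i).1) (s := (zl i).2) (b := (ol i).1)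
          (t := (ol i).2) h1 h2 (by rw [hv])
        have h8 : (zl i).2 ≠ (ol i).2 := fun h => h3 (Prod.ext hv h)
        have h9 : (fun o => (A (zl i).1 o != (zl i).2) && (A (ol i).1 o != (ol i).2)) =
            fun _ => false := by
          funext o
          have h10 : ∀ x y z : Bool, y ≠ z → ((x != y) && (x != z)) = false := by decide
          rw [← hv, h10 _ _ _ h8]
        rw [h9] at h7
        simpa [dieMeas] using h7
      exact ⟨by linarith, fun _ => by linarith⟩
    · by_cases hleader : ld (zl i).1 = ld (ol i).1
      · -- this clause ties a pair of variables together
        have hq : Q (zl i).1 := by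
          by_contra hq
          rw [hldN _ h4 hq] at hleader
          by_cases hy : U (ol i).1
          · exact h4 (hleader ▸ hldUU _ hy)
          · by_cases hqy : Q (ol i).1
            · rw [hldQ _ hqy] at hleader
              exact h4 (hleader ▸ hqy.2.1.1)
            · rw [hldN _ hy hqy] at hleader
              exact hv hleader
        have hup := hq.2.1
        -- The second literal belongs to the variable x to which the first is tied. Since x is
        -- outside `S`, it is no centre, and a second variable tied to x would be matched to the
        -- same clause `e x`. Hence the clause at hand is the tying clause itself.
        have hy : (ol i).1 = (ol (m (zl i).1)).1 := by
          rw [hldQ _ hq] at hleader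
          by_cases hy : U (ol i).1
          · by_cases hyS : (ol i).1 ∈ S
            · rw [hldS _ hyS] at hleader
              exact absurd (hleader ▸ (hl1 _ hyS).1) hup.2.1
            · rw [hldU _ hy hyS] at hleader
              exact hleader.symm
          · by_cases hqy : Q (ol i).1
            · rw [hldQ _ hqy] at hleader
              have h6 := hqy.2.2
              rw [← hleader, hq.2.2] at h6
              exact absurd (hm h6) hv
            · rw [hldN _ hy hqy] at hleader
              exact absurd (hleader ▸ hup.1) hy
        have hmi : m (zl i).1 = i := (hown _ i hup hi hy).2
        have hol : ol i = ((ol i).1, !σ (ol i).1) := by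
          have h6 := (he _ hup).2
          rw [hq.2.2, hmi] at h6
          exact h6
        have h7 := le_satProb_of_eq ld A (a := (zl i).1) (s := (zl i).2) (b := (ol i).1)
          (t := !σ (ol i).1) h1 (hol ▸ h2) hleader
        rw [hmi] at hup
        have hAz : A (zl i).1 = corrRule (zl i).2 := by simp [hA, h4, hq, hmi]
        have hAo : A (ol i).1 = coinRule (σ (ol i).1) := by
          simp [hA, hup.1, hup.2.1, hup.2.2.1]
        rw [hAz, hAo, dieMeas_corrRule_coinRule] at h7
        exact ⟨by linarith, fun _ => by linarith⟩
      · have h7 := le_satProb_of_ne ld A (a := (zl i).1) (s := (zl i).2) (b := (ol i).1)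
          (t := (ol i).2) h1 h2 hleader
        have h8 := hA5 (ol i) fun h => h.1.2.2 i hi (Prod.ext rfl h.2)
        rw [hA1 _ _ h4] at h7
        refine ⟨by linarith, ?_⟩
        rintro ⟨x, hx, rfl⟩
        exfalso
        have h9 := (he x hx).2
        have hox : (ol (e x)).1 = x := by rw [h9]
        have hz := hown x (e x) hx (he x hx).1 hox
        have hq : Q (zl (e x)).1 := ⟨hz.1, by rw [hz.2, hox]; exact hx, by rw [hz.2, hox]⟩
        rw [hldQ _ hq, hz.2, hox, hldU x hx.1 hx.2.1] at hleader
        exact hleader rfl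
  have hPK : ∀ i, K i → phi ≤ satProb ld A (c i) := by
    rintro i ⟨x, hx, hxi⟩
    have h1 := le_satProb_single ld A hxi
    by_cases hc : Uc x
    · rw [hA4 x hc] at h1; linarith
    · rw [hA3 x hx hc] at h1; linarith
  have hPc : ∀ i x, Uc x → c i = {(x, σ x)} → 1 ≤ satProb ld A (c i) := by
    intro i x hx hi
    have h1 := le_satProb_single ld A (a := x) (s := σ x) (c := c i) (by simp [hi])
    rw [hA4 x hx] at h1
    linarith
  -- negative clauses
  have hPB : ∀ i, ¬ M i → ¬ K i → phi ≤ satProb ld A (c i) ∧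
      ((l (zl i).1 ≠ (zl i).1 ∧ l (zl i).1 = (ol i).1 ∨
        l (ol i).1 ≠ (ol i).1 ∧ l (ol i).1 = (zl i).1) →
        phi + (2 - 3 * phi) ≤ satProb ld A (c i)) := by
    intro i h1 h2
    obtain ⟨h3, h4, h5, h6, h7, h8, h9⟩ := hB i h1 h2
    have hadj : Adj (zl i).1 (ol i).1 := ⟨i, h1, h2, Or.inl ⟨rfl, rfl⟩⟩
    have hzS : (zl i).1 ∈ S := by simp only [hSdef, Finset.mem_filter]; exact ⟨by simp, _, hadj⟩
    have hoS : (ol i).1 ∈ S := by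
      simp only [hSdef, Finset.mem_filter]; exact ⟨by simp, _, hAsymm _ _ hadj⟩
    have hzc : ¬ Uc (zl i).1 := fun h => h.2.1 hzS
    have hoc : ¬ Uc (ol i).1 := fun h => h.2.1 hoS
    have hzm : ((zl i).1, !σ (zl i).1) ∈ c i := h8 ▸ h3
    have hom : ((ol i).1, !σ (ol i).1) ∈ c i := h9 ▸ h4
    by_cases hleader : ld (zl i).1 = ld (ol i).1
    · have h10 := le_satProb_of_eq ld A hzm hom hleader
      rw [hldS _ hzS, hldS _ hoS] at hleader
      by_cases hz : l (zl i).1 = (zl i).1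
      · have ho : l (ol i).1 ≠ (ol i).1 := fun h => h5 (by rw [← hz, hleader, h])
        have hAz : A (zl i).1 = coinRule (σ (zl i).1) := by simp [hA, h6, hzS, hz]
        have hAo : A (ol i).1 = leafRule (b (ol i).1) (σ (ol i).1) := by simp [hA, h7, hoS, ho]
        rw [hAz, hAo, dieMeas_coinRule_leafRule] at h10
        exact ⟨by linarith, fun _ => by linarith⟩
      · have hAz : A (zl i).1 = leafRule (b (zl i).1) (σ (zl i).1) := by simp [hA, h6, hzS, hz]
        by_cases ho : l (ol i).1 = (ol i).1
        · have hAo : A (ol i).1 = coinRule (σ (ol i).1) := by simp [hA, h7, hoS, ho]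
          rw [hAz, hAo, dieMeas_leafRule_coinRule] at h10
          exact ⟨by linarith, fun _ => by linarith⟩
        · have hAo : A (ol i).1 = leafRule (b (ol i).1) (σ (ol i).1) := by simp [hA, h7, hoS, ho]
          rw [hAz, hAo, dieMeas_leafRule_leafRule _ _ (hl4 _ hzS _ hoS hz ho hadj hleader)] at h10
          refine ⟨by linarith, ?_⟩
          rintro (⟨_, h⟩ | ⟨_, h⟩)
          · exact absurd (by rw [← h, (hl1 _ hzS).2]) ho
          · exact absurd (by rw [← h, (hl1 _ hoS).2]) hz
    · have h10 := le_satProb_of_ne ld A hzm hom hleader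
      rw [hA2 _ h6 hzc, hA2 _ h7 hoc] at h10
      refine ⟨by nlinarith, fun h => absurd ?_ hleader⟩
      rw [hldS _ hzS, hldS _ hoS]
      rcases h with ⟨_, h⟩ | ⟨_, h⟩
      · rw [← h, (hl1 _ hzS).2]
      · rw [← h, (hl1 _ hoS).2]
  -- the charges
  have hleaf : ∀ y, ∃ i, y ∈ S → ¬ M i ∧ ¬ K i ∧ (y = (zl i).1 ∨ y = (ol i).1) ∧
      ((l (zl i).1 ≠ (zl i).1 ∧ l (zl i).1 = (ol i).1 ∨
        l (ol i).1 ≠ (ol i).1 ∧ l (ol i).1 = (zl i).1)) := by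
    intro y
    by_cases hy : y ∈ S
    -- A leaf is charged to the edge to its centre, and a centre to the edge to one of its leaves,
    -- which exists because no star is trivial.
    · obtain ⟨x, hx, hxl, hxy⟩ : ∃ x ∈ S, l x ≠ x ∧ (y = x ∨ y = l x) := by
        by_cases h : l y = y
        · obtain ⟨x, hx, hxy, hlx⟩ := hl3 y hy h
          exact ⟨x, hx, by rw [hlx]; exact hxy.symm, Or.inr hlx.symm⟩
        · exact ⟨y, hy, h, Or.inl rfl⟩
      obtain ⟨i, h1, h2, h3⟩ := hl2 x hx hxl
      refine ⟨i, fun _ => ⟨h1, h2, ?_⟩⟩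
      rcases h3 with ⟨h3, h4⟩ | ⟨h3, h4⟩
      · rw [h3, h4]; exact ⟨hxy, Or.inl ⟨hxl, rfl⟩⟩
      · rw [h3, h4]; exact ⟨hxy.symm, Or.inr ⟨hxl, rfl⟩⟩
    · exact ⟨m y, fun h => absurd h hy⟩
  choose κS hκS using hleaf
  obtain ⟨κU, hκU⟩ : ∃ κU : V → ι, ∀ x, U x → c (κU x) = {(x, σ x)} := by
    refine ⟨fun x => if h : U x then (hUdef x h).choose else m x, fun x hx => ?_⟩
    simp only [hx, dif_pos]
    exact (hUdef x hx).choose_spec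
  obtain ⟨κb, hκb⟩ : ∃ κb : V → ι, ∀ x, Ub x → M (κb x) ∧ (ol (κb x)).1 = x ∧
      ∀ z, ¬ U z → m z ≠ κb x := by
    refine ⟨fun x => if h : Ub x then h.choose else m x, fun x hx => ?_⟩
    simp only [hx, dif_pos]
    exact hx.choose_spec
  set κ : V → ι := fun v => if U v then
    if v ∈ S then κS v else if Uc v then κU v else if Ub v then κb v else e v
    else m v with hκ
  -- what is charged to a clause
  have hch : ∀ v, (¬ U v ∧ κ v = m v ∧ M (κ v)) ∨
      (v ∈ S ∧ κ v = κS v ∧ ¬ M (κ v) ∧ ¬ K (κ v)) ∨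
      (Uc v ∧ κ v = κU v ∧ ¬ M (κ v) ∧ K (κ v)) ∨ (Ub v ∧ κ v = κb v ∧ M (κ v)) ∨
      (Up v ∧ κ v = e v ∧ M (κ v)) := by
    intro v
    by_cases h1 : U v
    · by_cases h2 : v ∈ S
      · have : κ v = κS v := by simp [hκ, h1, h2]
        exact Or.inr (Or.inl ⟨h2, this, this ▸ (hκS v h2).1, this ▸ (hκS v h2).2.1⟩)
      · by_cases h3 : Uc v
        · have h4 : κ v = κU v := by simp [hκ, h1, h2, h3]
          refine Or.inr (Or.inr (Or.inl ⟨h3, h4, ?_, ?_⟩))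
          · rintro ⟨z, s, hz, hzs⟩
            rw [h4, hκU v h1, Finset.mem_singleton, Prod.ext_iff] at hzs
            have : z = v := hzs.1
            exact hz (this ▸ h1)
          · exact ⟨v, h1, by simp [h4, hκU v h1]⟩
        · by_cases h4 : Ub v
          · have : κ v = κb v := by simp [hκ, h1, h2, h3, h4]
            exact Or.inr (Or.inr (Or.inr (Or.inl ⟨h4, this, this ▸ (hκb v h4).1⟩)))
          · have : κ v = e v := by simp [hκ, h1, h2, h3, h4]
            have hp : Up v := ⟨h1, h2, h3, h4⟩
            exact Or.inr (Or.inr (Or.inr (Or.inr ⟨hp, this, this ▸ (he v hp).1⟩)))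
    · have : κ v = m v := by simp [hκ, h1]
      exact Or.inl ⟨h1, this, this ▸ hmM v h1⟩
  refine exists_assignment_of_charge c w hw ld A κ fun i => ?_
  set T : Finset V := Finset.univ.filter fun v => κ v = i with hT
  have hTmem : ∀ v, v ∈ T ↔ κ v = i := by simp [hT]
  have card1 : (∃ a, T ⊆ {a}) → (T.card : ℝ) ≤ 1 := by
    rintro ⟨a, ha⟩
    exact_mod_cast (Finset.card_le_card ha).trans (by simp)
  have card2 : (∃ a a', T ⊆ {a, a'}) → (T.card : ℝ) ≤ 2 := by
    rintro ⟨a, a', ha⟩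
    exact_mod_cast (Finset.card_le_card ha).trans Finset.card_le_two
  have hδ : 0 ≤ 2 - 3 * phi := by linarith
  rcases T.eq_empty_or_nonempty with hT0 | ⟨v, hv⟩
  · rw [hT0]
    have : phi ≤ satProb ld A (c i) := by
      by_cases h1 : M i
      · have := (hPM i h1).1; linarith
      · by_cases h2 : K i
        · exact hPK i h2
        · exact (hPB i h1 h2).1
    simpa using this
  by_cases h1 : M i
  · have hPi := hPM i h1
    -- A tying clause carries at most the variables of its two chosen literals and has surplus for
    -- both. Any other clause of kind `M` carries at most one: the first if it is matched to a
    -- variable outside `U`, otherwise the second.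
    by_cases hx : ∃ x, Up x ∧ e x = i
    · have h2 := card2 ⟨(zl i).1, (ol i).1, fun v hv => by
        have hvi := (hTmem v).1 hv
        simp only [Finset.mem_insert, Finset.mem_singleton]
        rcases hch v with h | h | h | h | h
        · exact Or.inl ((hM i h1).2.2.2.2 v h.1 (h.2.1 ▸ hvi)).symm
        · exact absurd h1 (hvi ▸ h.2.2.1)
        · exact absurd h1 (hvi ▸ h.2.2.1)
        · right; rw [← hvi, h.2.1, (hκb v h.1).2.1]
        · right; rw [← hvi, h.2.1, (he v h.1).2]⟩
      have h3 := hPi.2 hx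
      nlinarith
    · have h2 : (T.card : ℝ) ≤ 1 := by
        by_cases ho : ∃ z, ¬ U z ∧ m z = i
        · refine card1 ⟨(zl i).1, fun v hv => ?_⟩
          have hvi := (hTmem v).1 hv
          rw [Finset.mem_singleton]
          rcases hch v with h | h | h | h | h
          · exact ((hM i h1).2.2.2.2 v h.1 (h.2.1 ▸ hvi)).symm
          · exact absurd h1 (hvi ▸ h.2.2.1)
          · exact absurd h1 (hvi ▸ h.2.2.1)
          · obtain ⟨z, hz, hzi⟩ := ho
            exact absurd (by rw [hzi, ← hvi, h.2.1]) ((hκb v h.1).2.2 z hz)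
          · exact absurd ⟨v, h.1, h.2.1 ▸ hvi⟩ hx
        · refine card1 ⟨(ol i).1, fun v hv => ?_⟩
          have hvi := (hTmem v).1 hv
          rw [Finset.mem_singleton]
          rcases hch v with h | h | h | h | h
          · exact absurd ⟨v, h.1, h.2.1 ▸ hvi⟩ ho
          · exact absurd h1 (hvi ▸ h.2.2.1)
          · exact absurd h1 (hvi ▸ h.2.2.1)
          · rw [← hvi, h.2.1, (hκb v h.1).2.1]
          · exact absurd ⟨v, h.1, h.2.1 ▸ hvi⟩ hx
      nlinarith [hPi.1]
  · by_cases h2 : K i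
    · have key : ∀ v ∈ T, Uc v ∧ c i = {(v, σ v)} := by
        intro v hv
        have hvi := (hTmem v).1 hv
        rcases hch v with h | h | h | h | h
        · exact absurd (hvi ▸ h.2.2) h1
        · exact absurd h2 (hvi ▸ h.2.2.2)
        · exact ⟨h.1, by rw [← hvi, h.2.1, hκU v h.1.1]⟩
        · exact absurd (hvi ▸ h.2.2) h1
        · exact absurd (hvi ▸ h.2.2) h1
      obtain ⟨h3, h4⟩ := key v hv
      have h5 := hPc i v h3 h4
      have h6 := card1 ⟨v, fun x hx => by
        have := (key x hx).2
        rw [h4, Finset.singleton_inj, Prod.ext_iff] at this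
        simpa using this.1.symm⟩
      nlinarith
    · have key : ∀ v ∈ T, v ∈ S ∧ i = κS v := by
        intro v hv
        have hvi := (hTmem v).1 hv
        rcases hch v with h | h | h | h | h
        · exact absurd (hvi ▸ h.2.2) h1
        · exact ⟨h.1, by rw [← hvi, h.2.1]⟩
        · exact absurd (hvi ▸ h.2.2.2) h2
        · exact absurd (hvi ▸ h.2.2) h1
        · exact absurd (hvi ▸ h.2.2) h1
      obtain ⟨h3, h4⟩ := key v hv
      have h5 := (hPB i h1 h2).2 (by
        have := (hκS v h3).2.2.2
        rwa [← h4] at this)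
      have h6 := card2 ⟨(zl i).1, (ol i).1, fun x hx => by
        obtain ⟨h7, h8⟩ := key x hx
        have := (hκS x h7).2.2.1
        rw [← h8] at this
        simpa using this⟩
      nlinarith

/-! ### Separating sets of clauses -/

/-- The variable `v` occurs in the clause number `i` of the list. -/
def Occurs (L : ClauseList) (i v : ℕ) : Prop :=
  ∃ e, L[i]? = some e ∧ ∃ b, (v, b) ∈ e.2

/-- The clauses of the list with a number in the given set. -/
def keepEntries (L : ClauseList) (keep : ℕ → Bool) : ClauseList :=
  (L.zipIdx.filter fun p => keep p.2).map Prod.fst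

/-- A set of clauses separates the list if its clauses can be matched to variables that occur in no
other clause, and the variables of the other clauses can be matched to these. -/
structure Separates (L : ClauseList) (keep : ℕ → Bool) : Prop where
  inner : ∃ x : ℕ → ℕ, (∀ i, i < L.length → keep i = true → Occurs L i (x i) ∧
      ∀ j, Occurs L j (x i) → keep j = true) ∧
    ∀ i j, i < L.length → j < L.length → keep i = true → keep j = true → x i = x j → i = j
  outer : ∃ m : ℕ → ℕ, (∀ v i, Occurs L i v → keep i = false → Occurs L (m v) v ∧ keep (m v) = false) ∧
    ∀ v i v' i', Occurs L i v → keep i = false → Occurs L i' v' → keep i' = false → m v = m v' → v = v'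

lemma sum_map_zipIdx {α : Type*} (L : List α) (f : α × ℕ → ℕ) :
    (L.zipIdx.map f).sum = ∑ i : Fin L.length, f (L[i], i) := by
  have : L.zipIdx.map f = List.ofFn fun i : Fin L.length => f (L[i], i) := by
    apply List.ext_getElem <;> simp
  rw [this, List.sum_ofFn]

lemma sum_map_filter_eq {α : Type*} (L : List α) (p : α → Bool) (f : α → ℕ) :
    ((L.filter p).map f).sum = (L.map fun a => if p a then f a else 0).sum := by
  induction L with
  | nil => simp
  | cons a L ih => by_cases h : p a <;> simp [h, ih]

lemma sum_filter_eq_sum_fin (L : ClauseList) (p : ℕ × List Literal → Bool) :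
    ((L.filter p).map Prod.fst).sum = ∑ i : Fin L.length, if p L[i] then (L[i]).1 else 0 := by
  rw [sum_map_filter_eq, ← sum_map_zipIdx L (fun q => if p q.1 then q.1.1 else 0)]
  conv_lhs => rw [← List.zipIdx_map_fst 0 L, List.map_map]
  rfl

lemma sum_filter_keepEntries (L : ClauseList) (keep : ℕ → Bool) (p : ℕ × List Literal → Bool) :
    (((keepEntries L keep).filter p).map Prod.fst).sum =
      ∑ i : Fin L.length, if keep i ∧ p L[i] then (L[i]).1 else 0 := by
  rw [sum_map_filter_eq, keepEntries, List.map_map, sum_map_filter_eq]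
  refine (sum_map_zipIdx L _).trans (Finset.sum_congr rfl fun i _ => ?_)
  by_cases h : keep i = true <;> simp [h]

lemma mem_keepEntries {L : ClauseList} {keep : ℕ → Bool} {e : ℕ × List Literal} :
    e ∈ keepEntries L keep ↔ ∃ i : Fin L.length, keep i = true ∧ L[i] = e := by
  simp only [keepEntries, List.mem_map, List.mem_filter, Prod.exists, exists_and_right,
    exists_eq_right]
  constructor
  · rintro ⟨i, h1, h2⟩
    obtain ⟨h3, h4⟩ := List.mk_mem_zipIdx_iff_getElem?.1 h1 |> List.getElem?_eq_some_iff.1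
    exact ⟨⟨i, h3⟩, h2, h4⟩
  · rintro ⟨i, h1, h2⟩
    refine ⟨i, List.mk_mem_zipIdx_iff_getElem?.2 ?_, h1⟩
    rw [← h2]
    simp

lemma occurs_fin {L : ClauseList} (i : Fin L.length) (v : ℕ) :
    Occurs L i v ↔ ∃ b, (v, b) ∈ (L[i]).2 := by
  simp [Occurs]

lemma Occurs.lt {L : ClauseList} {i v : ℕ} (h : Occurs L i v) : i < L.length := by
  obtain ⟨e, he, _⟩ := h
  exact (List.getElem?_eq_some_iff.1 he).1

lemma Presents.mem_clauses {L : ClauseList} {F : CNF} (hL : Presents L F)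
    (i : Fin L.length) : (L[i]).2.toFinset ∈ F.clauses := by
  rw [hL.2.1]; simp only [List.mem_toFinset, List.mem_map]
  exact ⟨L[i], List.getElem_mem _, rfl⟩

lemma Presents.exists_of_mem {L : ClauseList} {F : CNF} (hL : Presents L F) {c : Clause} (hc : c ∈ F.clauses) :
    ∃ i : Fin L.length, (L[i]).2.toFinset = c := by
  rw [hL.2.1] at hc
  simp only [List.mem_toFinset, List.mem_map] at hc
  obtain ⟨e, he, rfl⟩ := hc
  obtain ⟨i, hi, rfl⟩ := List.getElem_of_mem he
  exact ⟨⟨i, hi⟩, rfl⟩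

/-- The weight of a clause is the sum over its occurrences, so exchanging sums turns a sum over
clauses into one over list entries. Repeated entries then need no special treatment. -/
lemma Presents.sum_weight {L : ClauseList} {F : CNF} (hL : Presents L F)
    (p : Clause → Prop) [DecidablePred p] :
    ∑ c ∈ F.clauses with p c, F.weight c =
      ∑ i : Fin L.length, if p (L[i]).2.toFinset then (L[i]).1 else 0 := by
  have h : ∀ c, F.weight c = ∑ i : Fin L.length, if (L[i]).2.toFinset = c then (L[i]).1 else 0 := by
    intro c
    rw [hL.2.2 c, sum_filter_eq_sum_fin]
    simp
  simp only [h]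
  rw [Finset.sum_comm]
  refine Finset.sum_congr rfl fun i _ => ?_
  rw [Finset.sum_ite_eq]
  refine if_congr ?_ rfl rfl
  rw [Finset.mem_filter]
  exact and_iff_right (hL.mem_clauses i)

lemma Presents.mem_vars {L : ClauseList} {F : CNF} (hL : Presents L F) {v : ℕ} : v ∈ F.vars ↔ ∃ i, Occurs L i v := by
  simp only [CNF.vars, Finset.mem_biUnion, Finset.mem_image, Prod.exists, exists_and_right,
    exists_eq_right]
  constructor
  · rintro ⟨c, hc, b, hb⟩
    obtain ⟨i, rfl⟩ := hL.exists_of_mem hc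
    exact ⟨i, (occurs_fin i v).2 ⟨b, by simpa using hb⟩⟩
  · rintro ⟨i, hi⟩
    have := hi.lt
    obtain ⟨b, hb⟩ := (occurs_fin ⟨i, this⟩ v).1 hi
    exact ⟨_, hL.mem_clauses ⟨i, this⟩, b, by simpa using hb⟩

/-- The clauses of a separating set form a subformula for which the bound holds. -/
theorem Presents.exists_subformula {L : ClauseList} {F : CNF} (hL : Presents L F)
    (hF : F.UnitConflictFree) {keep : ℕ → Bool}
    (hk : Separates L keep) :
    ∃ F' : CNF, Presents (keepEntries L keep) F' ∧ F'.IsSubformula F ∧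
      (F.sat : ℝ) ≥ phi * (F.totalWeight : ℝ) + (1 - phi) * (F'.totalWeight : ℝ)
        + (2 - 3 * phi) * ((F.vars \ F'.vars).card : ℝ) / 2 := by
  classical
  obtain ⟨⟨x, hx, hxinj⟩, ⟨m, hm, hminj⟩⟩ := hk
  -- equal clauses are kept together
  have hsame : ∀ i j : Fin L.length, (L[i]).2.toFinset = (L[j]).2.toFinset → keep i = true →
      keep j = true := by
    intro i j hij hi
    obtain ⟨h1, h2⟩ := hx i i.2 hi
    refine h2 j ?_
    obtain ⟨b, hb⟩ := (occurs_fin i _).1 h1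
    rw [← List.mem_toFinset, hij, List.mem_toFinset] at hb
    exact (occurs_fin j _).2 ⟨b, hb⟩
  set C' : Finset Clause := ((keepEntries L keep).map fun e => e.2.toFinset).toFinset with hC'
  have hC'mem : ∀ c, c ∈ C' ↔ ∃ i : Fin L.length, keep i = true ∧ (L[i]).2.toFinset = c := by
    intro c
    simp only [hC', List.mem_toFinset, List.mem_map, mem_keepEntries]
    constructor
    · rintro ⟨e, ⟨i, h1, rfl⟩, h2⟩; exact ⟨i, h1, h2⟩
    · rintro ⟨i, h1, h2⟩; exact ⟨_, ⟨i, h1, rfl⟩, h2⟩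
  have hsub : C' ⊆ F.clauses := by
    intro c hc
    obtain ⟨i, _, rfl⟩ := (hC'mem c).1 hc
    exact hL.mem_clauses i
  set wt : Clause → ℕ := fun c =>
    (((keepEntries L keep).filter fun e => e.2.toFinset = c).map Prod.fst).sum with hwt
  have hwt' : ∀ c, wt c = ∑ i : Fin L.length,
      if keep i ∧ (L[i]).2.toFinset = c then (L[i]).1 else 0 := by
    intro c
    rw [hwt]; dsimp only
    rw [sum_filter_keepEntries]; simp
  have hwF : ∀ c ∈ C', wt c = F.weight c := by
    intro c hc
    obtain ⟨j, hj, rfl⟩ := (hC'mem c).1 hc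
    rw [hwt', hL.2.2, sum_filter_eq_sum_fin]
    refine Finset.sum_congr rfl fun i _ => if_congr ?_ rfl rfl
    rw [decide_eq_true_eq]
    exact ⟨fun h => h.2, fun h => ⟨hsame j i h.symm hj, h⟩⟩
  let F' : CNF :=
    { clauses := C'
      weight := wt
      nonempty := fun c hc => F.nonempty c (hsub hc)
      weight_pos := fun c hc => hwF c hc ▸ F.weight_pos c (hsub hc)
      weight_eq_zero := fun c hc => by
        rw [hwt']
        refine Finset.sum_eq_zero fun i _ => ?_
        rw [if_neg]
        rintro ⟨h1, h2⟩
        exact hc ((hC'mem c).2 ⟨i, h1, h2⟩) }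
  have hF' : Presents (keepEntries L keep) F' := by
    refine ⟨?_, rfl, fun c => rfl⟩
    intro e he
    obtain ⟨i, _, rfl⟩ := mem_keepEntries.1 he
    exact hL.1 _ (List.getElem_mem _)
  refine ⟨F', hF', ⟨hsub, hwF⟩, ?_⟩
  -- the formula without the clauses of the subformula
  set V : Finset ℕ := F.vars.filter fun v => ∃ j, Occurs L j v ∧ keep j = false with hV
  have hVmem : ∀ v, v ∈ V ↔ ∃ j, Occurs L j v ∧ keep j = false := by
    intro v
    rw [hV, Finset.mem_filter, hL.mem_vars]
    exact ⟨fun h => h.2, fun h => ⟨⟨_, h.choose_spec.1⟩, h⟩⟩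
  let ι := {i : Fin L.length // keep i = false}
  let cl : ι → Finset (V × Bool) := fun i =>
    Finset.univ.filter fun l => ((l.1 : ℕ), l.2) ∈ (L[i.1]).2
  have hclmem : ∀ (i : ι) (v : V) b, (v, b) ∈ cl i ↔ ((v : ℕ), b) ∈ (L[i.1]).2 := by
    intro i v b; simp [cl]
  have hinV : ∀ (i : ι) v b, (v, b) ∈ (L[i.1]).2 → v ∈ V := fun i v b h =>
    (hVmem v).2 ⟨i.1, (occurs_fin i.1 v).2 ⟨b, h⟩, i.2⟩
  have hsingle : ∀ (i : ι) (v : V) b, cl i = {(v, b)} → (L[i.1]).2.toFinset = {((v : ℕ), b)} := by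
    intro i v b h
    ext ⟨u, s⟩
    rw [List.mem_toFinset, Finset.mem_singleton]
    constructor
    · intro hu
      have h1 : ((⟨u, hinV i u s hu⟩ : V), s) ∈ cl i := (hclmem _ _ _).2 hu
      rw [h, Finset.mem_singleton] at h1
      have h2 := Prod.ext_iff.1 h1
      exact Prod.ext (congrArg Subtype.val h2.1) h2.2
    · intro hu
      have h1 : (v, b) ∈ cl i := by rw [h]; simp
      rw [hu]
      exact (hclmem _ _ _).1 h1
  have hmv : ∀ v : V, Occurs L (m v) v ∧ keep (m v) = false := fun v => by
    obtain ⟨j, h1, h2⟩ := (hVmem v).1 v.2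
    exact hm v j h1 h2
  obtain ⟨α, hα⟩ := exists_assignment_of_matching cl (fun i => (L[i.1]).1)
    (fun i => hL.1 _ (List.getElem_mem _))
    (fun i => by
      obtain ⟨⟨u, s⟩, hu⟩ := F.nonempty _ (hL.mem_clauses i.1)
      rw [List.mem_toFinset] at hu
      exact ⟨(⟨u, hinV i u s hu⟩, s), (hclmem _ _ _).2 hu⟩)
    (fun v i j h => hF v ⟨hsingle i v _ h.1 ▸ hL.mem_clauses i.1,
      hsingle j v _ h.2 ▸ hL.mem_clauses j.1⟩)
    (fun v => ⟨⟨m v, (hmv v).1.lt⟩, (hmv v).2⟩)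
    (fun v v' h => by
      obtain ⟨j, h1, h2⟩ := (hVmem v).1 v.2
      obtain ⟨j', h1', h2'⟩ := (hVmem v').1 v'.2
      exact Subtype.ext (hminj v j v' j' h1 h2 h1' h2'
        (congrArg (fun i : ι => (i.1 : ℕ)) h)))
    (fun v => by
      obtain ⟨b, hb⟩ := (occurs_fin ⟨m v, (hmv v).1.lt⟩ v).1 (hmv v).1
      exact ⟨b, (hclmem _ _ _).2 hb⟩)
  -- an assignment of all variables
  let β : ℕ → Bool := fun v =>
    if h : ∃ i : Fin L.length, keep i = true ∧ x i = v then
      decide ((v, true) ∈ (L[h.choose]).2)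
    else if h : v ∈ V then α ⟨v, h⟩ else false
  have hβ1 : ∀ i : Fin L.length, keep i = true → (x i, β (x i)) ∈ (L[i]).2 := by
    intro i hi
    have h : ∃ j : Fin L.length, keep j = true ∧ x j = x i := ⟨i, hi, rfl⟩
    have h1 : h.choose = i := Fin.ext
      (hxinj _ _ h.choose.2 i.2 h.choose_spec.1 hi h.choose_spec.2)
    obtain ⟨b, hb⟩ := (occurs_fin i _).1 (hx i i.2 hi).1
    have h2 : β (x i) = decide ((x i, true) ∈ (L[i]).2) := by
      simp only [β, h, dif_pos, h1]
    rw [h2]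
    by_cases h3 : (x i, true) ∈ (L[i]).2
    · rw [decide_eq_true h3]; exact h3
    · rw [decide_eq_false h3]
      cases b
      · exact hb
      · exact absurd hb h3
  have hβ2 : ∀ v : V, β v = α v := by
    intro v
    have h : ¬ ∃ i : Fin L.length, keep i = true ∧ x i = v := by
      rintro ⟨i, hi, hiv⟩
      obtain ⟨j, h1, h2⟩ := (hVmem v).1 v.2
      have := (hx i i.2 hi).2 j (hiv ▸ h1)
      simp [this] at h2
    simp [β, h]
  have hsat : ∀ (i : Fin L.length) v, (v, β v) ∈ (L[i]).2 →
      F.Satisfies (fun v => β v) (L[i]).2.toFinset := by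
    intro i v hv
    exact ⟨⟨v, hL.mem_vars.2 ⟨i, (occurs_fin i v).2 ⟨_, hv⟩⟩⟩, by simpa using hv⟩
  have hsum : ∀ f : Fin L.length → ℝ, ∑ i : ι, f i.1 =
      ∑ i : Fin L.length, if keep i then 0 else f i := by
    intro f
    rw [← Finset.sum_subtype (Finset.univ.filter fun i : Fin L.length => keep i = false) (by simp) f,
      Finset.sum_filter]
    refine Finset.sum_congr rfl fun i _ => ?_
    cases keep i <;> simp
  have e1 : (F.totalWeight : ℝ) = ∑ i : Fin L.length, ((L[i]).1 : ℝ) := by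
    have := hL.sum_weight fun _ => True
    simp only [Finset.filter_true, if_true] at this
    rw [CNF.totalWeight, this, Nat.cast_sum]
  have e2 : (F'.totalWeight : ℝ) = ∑ i : Fin L.length, if keep i then ((L[i]).1 : ℝ) else 0 := by
    have h1 := hL.sum_weight fun c => c ∈ C'
    have h2 : F.clauses.filter (fun c => c ∈ C') = C' := by
      ext c; rw [Finset.mem_filter]; exact ⟨fun h => h.2, fun h => ⟨hsub h, h⟩⟩
    have h3 : F'.totalWeight = ∑ c ∈ C', F.weight c := Finset.sum_congr rfl hwF
    rw [h2] at h1
    rw [h3, h1, Nat.cast_sum]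
    refine Finset.sum_congr rfl fun i _ => ?_
    rw [Nat.cast_ite, Nat.cast_zero]
    refine if_congr ?_ rfl rfl
    rw [hC'mem]
    exact ⟨fun ⟨j, h1, h2⟩ => hsame j i h2 h1, fun h => ⟨i, h, rfl⟩⟩
  have e3 : (F.assignmentWeight fun v => β v : ℝ) = ∑ i : Fin L.length,
      if F.Satisfies (fun v => β v) (L[i]).2.toFinset then ((L[i]).1 : ℝ) else 0 := by
    rw [CNF.assignmentWeight, hL.sum_weight, Nat.cast_sum]
    refine Finset.sum_congr rfl fun i _ => ?_
    rw [Nat.cast_ite, Nat.cast_zero]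
  have e4 : (F.assignmentWeight fun v => β v : ℝ) ≤ F.sat := by
    exact_mod_cast Finset.le_sup (f := F.assignmentWeight) (Finset.mem_univ fun v : F.vars => β v)
  have e5 : phi * ∑ i : ι, ((L[i.1]).1 : ℝ) + (2 - 3 * phi) / 2 * Fintype.card V ≤ ∑ i : Fin L.length,
      if keep i then 0 else
        if F.Satisfies (fun v => β v) (L[i]).2.toFinset then ((L[i]).1 : ℝ) else 0 := by
    refine hα.trans ?_
    rw [← hsum fun i => if F.Satisfies (fun v => β v) (L[i]).2.toFinset then ((L[i]).1 : ℝ) else 0,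
      Finset.sum_filter]
    refine Finset.sum_le_sum fun i _ => ?_
    by_cases h : ∃ v, (v, α v) ∈ cl i
    · obtain ⟨v, hv⟩ := h
      have h1 := hsat i.1 v (by rw [hβ2]; exact (hclmem _ _ _).1 hv)
      rw [if_pos ⟨v, hv⟩, if_pos h1]
    · rw [if_neg h]
      split_ifs <;> positivity
  have e6 : ∑ i : ι, ((L[i.1]).1 : ℝ) = F.totalWeight - F'.totalWeight := by
    rw [hsum fun i => ((L[i]).1 : ℝ), e1, e2, ← Finset.sum_sub_distrib]
    refine Finset.sum_congr rfl fun i _ => ?_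
    split_ifs <;> simp
  have e7 : (F'.totalWeight : ℝ) + ∑ i : Fin L.length, (if keep i then 0 else
        if F.Satisfies (fun v => β v) (L[i]).2.toFinset then ((L[i]).1 : ℝ) else 0) =
      F.assignmentWeight fun v => β v := by
    rw [e2, e3, ← Finset.sum_add_distrib]
    refine Finset.sum_congr rfl fun i _ => ?_
    by_cases h : keep i = true
    · rw [if_pos h, if_pos h, if_pos (hsat i _ (hβ1 i h)), add_zero]
    · rw [if_neg h, if_neg h, zero_add]
  -- A variable absent from F' occurs only in clauses that are not kept. The inclusion can be
  -- strict, which is harmless as 2 - 3φ is positive.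
  have e8 : ((F.vars \ F'.vars).card : ℝ) ≤ Fintype.card V := by
    rw [Fintype.card_coe]
    refine Nat.cast_le.2 (Finset.card_le_card fun v hv => ?_)
    rw [Finset.mem_sdiff] at hv
    obtain ⟨i, hi⟩ := hL.mem_vars.1 hv.1
    refine (hVmem v).2 ⟨i, hi, ?_⟩
    by_contra h
    rw [Bool.not_eq_false] at h
    obtain ⟨b, hb⟩ := (occurs_fin ⟨i, hi.lt⟩ v).1 hi
    refine hv.2 (Finset.mem_biUnion.2 ⟨(L[(⟨i, hi.lt⟩ : Fin L.length)]).2.toFinset,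
      (hC'mem _).2 ⟨⟨i, hi.lt⟩, h, rfl⟩, Finset.mem_image.2 ⟨(v, b), ?_, rfl⟩⟩)
    rwa [List.mem_toFinset]
  have hδ : 0 ≤ (2 - 3 * phi) / 2 := by have := phi_lt; linarith
  have e9 := mul_le_mul_of_nonneg_left e8 hδ
  rw [e6] at e5
  linarith

/-! ### Reasoning about programs -/

/-- The program halts, after at most `B` steps and with a memory that satisfies `Q`. -/
def Halts (p : Program) (s : Memory) (B : ℕ) (Q : Memory → Prop) : Prop :=
  ∃ s' t, Runs p s s' t ∧ t ≤ B ∧ Q s'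

lemma Halts.mono {p : Program} {s : Memory} {B B' : ℕ} {Q Q' : Memory → Prop}
    (h : Halts p s B Q) (hB : B ≤ B') (hQ : ∀ s', Q s' → Q' s') : Halts p s B' Q' := by
  obtain ⟨s', t, h1, h2, h3⟩ := h
  exact ⟨s', t, h1, h2.trans hB, hQ _ h3⟩

lemma Halts.seq {p q : Program} {s : Memory} {B B' : ℕ} {Q Q' : Memory → Prop}
    (h : Halts p s B Q) (h' : ∀ s', Q s' → Halts q s' B' Q') : Halts (.seq p q) s (B + B') Q' := by
  obtain ⟨s₁, t₁, h1, h2, h3⟩ := h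
  obtain ⟨s₂, t₂, h4, h5, h6⟩ := h' s₁ h3
  exact ⟨s₂, t₁ + t₂, .seq h1 h4, by omega, h6⟩

lemma Halts.loop_zero {x : ℕ} {p : Program} {s : Memory} {Q : Memory → Prop} (hx : s.reg x = 0)
    (h : Q s) : Halts (.loop x p) s 1 Q :=
  ⟨s, 1, .loop_zero hx, le_rfl, h⟩

lemma Halts.loop_pos {x : ℕ} {p : Program} {s : Memory} {B B' : ℕ} {Q Q' : Memory → Prop}
    (hx : s.reg x ≠ 0) (h : Halts p s B Q) (h' : ∀ s', Q s' → Halts (.loop x p) s' B' Q') :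
    Halts (.loop x p) s (B + B' + 1) Q' := by
  obtain ⟨s₁, t₁, h1, h2, h3⟩ := h
  obtain ⟨s₂, t₂, h4, h5, h6⟩ := h' s₁ h3
  exact ⟨s₂, t₁ + t₂ + 1, .loop_pos hx h1 h4, by omega, h6⟩

lemma Halts.cond {x : ℕ} {p q : Program} {s : Memory} {B : ℕ} {Q : Memory → Prop}
    (hp : s.reg x ≠ 0 → Halts p s B Q) (hq : s.reg x = 0 → Halts q s B Q) :
    Halts (.cond x p q) s (B + 1) Q := by
  by_cases hx : s.reg x = 0
  · obtain ⟨s₁, t₁, h1, h2, h3⟩ := hq hx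
    exact ⟨s₁, t₁ + 1, .cond_zero hx h1, by omega, h3⟩
  · obtain ⟨s₁, t₁, h1, h2, h3⟩ := hp hx
    exact ⟨s₁, t₁ + 1, .cond_pos hx h1, by omega, h3⟩

/-- The rule for loops with an invariant `I` and a decreasing measure `μ`. -/
lemma Halts.loop {x : ℕ} {p : Program} (I : Memory → Prop) (μ : Memory → ℕ) (B : ℕ)
    (h : ∀ s, I s → s.reg x ≠ 0 → Halts p s B fun s' => I s' ∧ μ s' < μ s) (s : Memory) (hs : I s) :
    Halts (.loop x p) s ((B + 1) * μ s + 1) fun s' => I s' ∧ s'.reg x = 0 := by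
  induction hn : μ s using Nat.strong_induction_on generalizing s with
  | _ n ih =>
  by_cases hx : s.reg x = 0
  · exact (Halts.loop_zero hx ⟨hs, hx⟩).mono (by omega) fun _ h => h
  · obtain ⟨s₁, t₁, h1, h2, h3, h4⟩ := h s hs hx
    obtain ⟨s₂, t₂, h5, h6, h7⟩ := ih (μ s₁) (hn ▸ h4) s₁ h3 rfl
    refine ⟨s₂, t₁ + t₂ + 1, .loop_pos hx h1 h5, ?_, h7⟩
    have h8 : μ s₁ + 1 ≤ n := hn ▸ h4
    have h9 := Nat.mul_le_mul_left (B + 1) h8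
    rw [mul_add] at h9
    omega

namespace Program

/-- The program has no loops. -/
def loopFree : Program → Bool
  | seq p q => p.loopFree && q.loopFree
  | cond _ p q => p.loopFree && q.loopFree
  | loop _ _ => false
  | _ => true

/-- A bound for the number of steps of a program without loops. -/
def cost : Program → ℕ
  | seq p q => p.cost + q.cost
  | cond _ p q => max p.cost q.cost + 1
  | _ => 1

/-- The memory after a program without loops. -/
def eval : Program → Memory → Memory
  | const x n, s => s.setReg x n
  | add x y z, s => s.setReg x (s.reg y + s.reg z)
  | sub x y z, s => s.setReg x (s.reg y - s.reg z)
  | load x a y, s => s.setReg x (s.arr a (s.reg y))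
  | store a y x, s => s.setArr a (s.reg y) (s.reg x)
  | seq p q, s => q.eval (p.eval s)
  | cond x p q, s => if s.reg x = 0 then q.eval s else p.eval s
  | _, s => s

/-- The registers that a program may change. -/
def regs : Program → List ℕ
  | const x _ | add x _ _ | sub x _ _ | load x _ _ => [x]
  | seq p q | cond _ p q => p.regs ++ q.regs
  | loop _ p => p.regs
  | _ => []

/-- The arrays that a program may change. -/
def arrs : Program → List ℕ
  | store a _ _ => [a]
  | seq p q | cond _ p q => p.arrs ++ q.arrs
  | loop _ p => p.arrs
  | _ => []

lemma eval_reg {p : Program} {x : ℕ} (h : x ∉ p.regs) (s : Memory) :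
    (p.eval s).reg x = s.reg x := by
  induction p generalizing s with
  | seq p q ihp ihq =>
    simp only [regs, List.mem_append, not_or] at h
    rw [eval, ihq h.2, ihp h.1]
  | cond y p q ihp ihq =>
    simp only [regs, List.mem_append, not_or] at h
    rw [eval]
    split_ifs
    · exact ihq h.2 s
    · exact ihp h.1 s
  | skip | loop | store => rfl
  | _ =>
    simp only [regs, List.mem_singleton] at h
    simp [eval, Memory.setReg, h]

lemma eval_arr {p : Program} {a : ℕ} (h : a ∉ p.arrs) (s : Memory) :
    (p.eval s).arr a = s.arr a := by
  induction p generalizing s with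
  | seq p q ihp ihq =>
    simp only [arrs, List.mem_append, not_or] at h
    rw [eval, ihq h.2, ihp h.1]
  | cond y p q ihp ihq =>
    simp only [arrs, List.mem_append, not_or] at h
    rw [eval]
    split_ifs
    · exact ihq h.2 s
    · exact ihp h.1 s
  | store b y x =>
    simp only [arrs, List.mem_singleton] at h
    simp [eval, Memory.setArr, h]
  | _ => rfl

end Program

/-- Straight-line code and branches run deterministically within `cost`, so their correctness
reduces to computing `Program.eval`. Loops alone need invariants. -/
lemma Halts.block {p : Program} (hp : p.loopFree = true) {s : Memory} {B : ℕ} {Q : Memory → Prop}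
    (hB : p.cost ≤ B) (hQ : Q (p.eval s)) : Halts p s B Q := by
  have key : ∀ p : Program, p.loopFree = true → ∀ s, Halts p s p.cost fun s' => s' = p.eval s := by
    intro p
    induction p with
    | skip => exact fun _ s => ⟨_, _, .skip s, le_rfl, rfl⟩
    | const x n => exact fun _ s => ⟨_, _, .const x n s, le_rfl, rfl⟩
    | add x y z => exact fun _ s => ⟨_, _, .add x y z s, le_rfl, rfl⟩
    | sub x y z => exact fun _ s => ⟨_, _, .sub x y z s, le_rfl, rfl⟩
    | load x a y => exact fun _ s => ⟨_, _, .load x a y s, le_rfl, rfl⟩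
    | store a y x => exact fun _ s => ⟨_, _, .store a y x s, le_rfl, rfl⟩
    | seq p q ihp ihq =>
      intro h s
      simp only [Program.loopFree, Bool.and_eq_true] at h
      refine (ihp h.1 s).seq ?_
      rintro _ rfl
      exact ihq h.2 _
    | cond x p q ihp ihq =>
      intro h s
      simp only [Program.loopFree, Bool.and_eq_true] at h
      refine Halts.cond (fun hx => ?_) fun hx => ?_
      · simpa [Program.eval, hx] using (ihp h.1 s).mono (le_max_left _ q.cost) fun _ h => h
      · simpa [Program.eval, hx] using (ihq h.2 s).mono (le_max_right p.cost _) fun _ h => h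
    | loop x p => intro h; simp [Program.loopFree] at h
  refine (key p hp s).mono hB ?_
  rintro _ rfl
  exact hQ

@[simp] lemma Memory.reg_setReg (s : Memory) (x v : ℕ) :
    (s.setReg x v).reg = Function.update s.reg x v := rfl

@[simp] lemma Memory.arr_setReg (s : Memory) (x v : ℕ) : (s.setReg x v).arr = s.arr := rfl

@[simp] lemma Memory.reg_setArr (s : Memory) (a i v : ℕ) : (s.setArr a i v).reg = s.reg := rfl

@[simp] lemma Memory.arr_setArr (s : Memory) (a i v : ℕ) :
    (s.setArr a i v).arr = Function.update s.arr a (Function.update (s.arr a) i v) := rfl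

/-! ### Writing lists into arrays -/

/-- The array `f` after the list has been written into it from the position `k` on. -/
def writeAt (f : ℕ → ℕ) : ℕ → List ℕ → ℕ → ℕ
  | _, [] => f
  | k, x :: l => writeAt (Function.update f k x) (k + 1) l

lemma writeAt_append (f : ℕ → ℕ) (k : ℕ) (l l' : List ℕ) :
    writeAt f k (l ++ l') = writeAt (writeAt f k l) (k + l.length) l' := by
  induction l generalizing f k with
  | nil => rfl
  | cons x l ih => simp only [List.cons_append, writeAt, ih, List.length_cons]; congr 1; omega

lemma writeAt_of_lt (f : ℕ → ℕ) (k : ℕ) (l : List ℕ) {i : ℕ} (h : i < k) : writeAt f k l i = f i := by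
  induction l generalizing f k with
  | nil => rfl
  | cons x l ih =>
    rw [writeAt, ih _ _ (by omega), Function.update_of_ne (by omega)]

lemma writeAt_apply (f : ℕ → ℕ) (k : ℕ) (l : List ℕ) {i : ℕ} (h : i < l.length) :
    writeAt f k l (k + i) = l[i] := by
  induction l generalizing f k i with
  | nil => simp at h
  | cons x l ih =>
    rw [writeAt]
    cases i with
    | zero => rw [writeAt_of_lt _ _ _ (by omega)]; simp
    | succ i =>
      have := ih (Function.update f k x) (k + 1) (i := i) (by simpa using h)
      rw [show k + (i + 1) = k + 1 + i by omega, this]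
      rfl

/-- From the position `k` on, the array `f` holds the list `l`. -/
def HoldsAt (f : ℕ → ℕ) (k : ℕ) (l : List ℕ) : Prop :=
  ∀ i (h : i < l.length), f (k + i) = l[i]

lemma HoldsAt.head {f : ℕ → ℕ} {k x : ℕ} {l : List ℕ} (h : HoldsAt f k (x :: l)) : f k = x := by
  exact h 0 (by simp)

lemma HoldsAt.tail {f : ℕ → ℕ} {k x : ℕ} {l : List ℕ} (h : HoldsAt f k (x :: l)) :
    HoldsAt f (k + 1) l := by
  intro i hi
  have := h (i + 1) (by simpa using hi)
  rw [show k + 1 + i = k + (i + 1) by omega, this]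
  rfl

lemma HoldsAt.left {f : ℕ → ℕ} {k : ℕ} {l l' : List ℕ} (h : HoldsAt f k (l ++ l')) :
    HoldsAt f k l := by
  intro i hi
  rw [h i (by simp; omega), List.getElem_append_left]

lemma HoldsAt.right {f : ℕ → ℕ} {k : ℕ} {l l' : List ℕ} (h : HoldsAt f k (l ++ l')) :
    HoldsAt f (k + l.length) l' := by
  intro i hi
  have := h (l.length + i) (by simp; omega)
  rw [show k + l.length + i = k + (l.length + i) by omega, this, List.getElem_append_right (by omega)]
  simp

/-! ### Reading the input -/

/-- The numbers of the clauses, counted from `e`, and the names, increased by one, of the variables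
of all occurrences of literals. -/
def edgesFrom : ℕ → ClauseList → List (ℕ × ℕ)
  | _, [] => []
  | e, c :: L => (c.2.map fun l => (e, l.1 + 1)) ++ edgesFrom (e + 1) L

/-- For each number of the encoding of a list, the number of its clause, counted from `e`. -/
def tagsFrom : ℕ → ClauseList → List ℕ
  | _, [] => []
  | e, c :: L => List.replicate (2 + 2 * c.2.length) e ++ tagsFrom (e + 1) L

/-- Reads one literal. -/
def readLiteral : Program :=
  .seq (.store 3 1 3) <| .seq (.load 6 0 1) <| .seq (.add 6 6 5) <| .seq (.store 1 4 3) <|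
  .seq (.store 2 4 6) <| .seq (.add 4 4 5) <| .seq (.add 1 1 5) <| .seq (.store 3 1 3) <|
  .seq (.add 1 1 5) <| .sub 7 7 5

/-- Reads one clause. -/
def readClause : Program :=
  .seq (.seq (.store 3 1 3) <| .seq (.add 1 1 5) <| .seq (.store 3 1 3) <|
    .seq (.load 7 0 1) <| .add 1 1 5) <|
  .seq (.loop 7 readLiteral) <| .seq (.add 3 3 5) (.sub 2 0 1)

/-- Reads the input.  Register `1` is the position in the input, `3` counts the clauses, `4` counts
the occurrences of literals, `5` is `1`.  The arrays `1` and `2` take the clauses and the variables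
of the occurrences, and array `3` the clauses to which the numbers of the input belong. -/
def readInput : Program :=
  .seq (.seq (.const 5 1) (.sub 2 0 1)) (.loop 2 readClause)

/-- Two numbers are consumed per literal, with the variable name shifted by one so that 0 can later
mean "no variable". The registers from 8 on are tracked because register 20 must remain 0: adding it
copies a value. -/
lemma halts_readLiterals (ls : List Literal) (s : Memory) (h5 : s.reg 5 = 1)
    (h7 : s.reg 7 = ls.length)
    (h0 : HoldsAt (s.arr 0) (s.reg 1) (ls.flatMap fun l => [l.1, l.2.toNat])) :
    Halts (.loop 7 readLiteral) s (11 * ls.length + 1) fun s' =>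
      s'.arr = Function.update (Function.update (Function.update s.arr
        1 (writeAt (s.arr 1) (s.reg 4) (List.replicate ls.length (s.reg 3))))
        2 (writeAt (s.arr 2) (s.reg 4) (ls.map fun l => l.1 + 1)))
        3 (writeAt (s.arr 3) (s.reg 1) (List.replicate (2 * ls.length) (s.reg 3))) ∧
      s'.reg 0 = s.reg 0 ∧ s'.reg 1 = s.reg 1 + 2 * ls.length ∧ s'.reg 3 = s.reg 3 ∧
      s'.reg 4 = s.reg 4 + ls.length ∧ s'.reg 5 = 1 ∧ ∀ x, 8 ≤ x → s'.reg x = s.reg x := by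
  induction ls generalizing s with
  | nil =>
    refine Halts.loop_zero h7 ⟨?_, rfl, rfl, rfl, rfl, h5, fun _ _ => rfl⟩
    simp [writeAt]
  | cons l ls ih =>
    have hl : s.arr 0 (s.reg 1) = l.1 := by
      rw [List.flatMap_cons] at h0; exact h0.head
    have ht : HoldsAt (s.arr 0) (s.reg 1 + 2) (ls.flatMap fun l => [l.1, l.2.toNat]) := by
      rw [List.flatMap_cons] at h0; exact h0.right
    refine (Halts.loop_pos (B := 10) (B' := 11 * ls.length + 1)
      (Q := fun s' => s' = readLiteral.eval s) (by rw [h7]; simp)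
      (Halts.block rfl (by decide) rfl) ?_).mono (by simp; omega) fun _ h => h
    rintro _ rfl
    refine (ih (readLiteral.eval s) ?_ ?_ ?_).mono le_rfl ?_
    · simp [readLiteral, Program.eval, h5]
    · simp [readLiteral, Program.eval, h5, h7]
    · simpa [readLiteral, Program.eval, h5, add_assoc] using ht
    · rintro s' ⟨g1, g2, g3, g4, g5, g6, g7⟩
      refine ⟨?_, ?_, ?_, ?_, ?_, g6, ?_⟩
      · rw [g1]
        funext a
        simp [readLiteral, Program.eval, h5, hl, Function.update_apply, writeAt,
          List.replicate_succ, mul_add, add_assoc]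
        rcases eq_or_ne a 3 with rfl | h3
        · simp
        rcases eq_or_ne a 2 with rfl | h2
        · simp
        rcases eq_or_ne a 1 with rfl | h1
        · simp
        simp [h3, h2, h1]
      · rw [g2]; simp [readLiteral, Program.eval]
      · rw [g3]; simp [readLiteral, Program.eval, h5]; ring
      · rw [g4]; simp [readLiteral, Program.eval]
      · rw [g5]; simp [readLiteral, Program.eval, h5]; ring
      · intro x hx
        rw [g7 x hx]
        have : x ≠ 7 ∧ x ≠ 1 ∧ x ≠ 4 ∧ x ≠ 6 := by omega
        simp [readLiteral, Program.eval, this]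

lemma halts_readClauses (L : ClauseList) (s : Memory) (h5 : s.reg 5 = 1)
    (h2 : s.reg 2 = s.reg 0 - s.reg 1) (hN : s.reg 0 = s.reg 1 + (encode L).length)
    (h0 : HoldsAt (s.arr 0) (s.reg 1) (encode L)) :
    Halts (.loop 2 readClause) s (12 * (encode L).length + 1) fun s' =>
      s'.arr = Function.update (Function.update (Function.update s.arr
        1 (writeAt (s.arr 1) (s.reg 4) ((edgesFrom (s.reg 3) L).map Prod.fst)))
        2 (writeAt (s.arr 2) (s.reg 4) ((edgesFrom (s.reg 3) L).map Prod.snd)))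
        3 (writeAt (s.arr 3) (s.reg 1) (tagsFrom (s.reg 3) L)) ∧
      s'.reg 0 = s.reg 0 ∧ s'.reg 3 = s.reg 3 + L.length ∧
      s'.reg 4 = s.reg 4 + (edgesFrom (s.reg 3) L).length ∧ s'.reg 5 = 1 ∧
      ∀ x, 8 ≤ x → s'.reg x = s.reg x := by
  induction L generalizing s with
  | nil =>
    refine Halts.loop_zero ?_ ⟨?_, rfl, rfl, rfl, h5, fun _ _ => rfl⟩
    · rw [h2, hN]; simp [encode]
    · simp [writeAt, edgesFrom, tagsFrom]
  | cons c L ih =>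
    have hlen : (encode (c :: L)).length = 2 + 2 * c.2.length + (encode L).length := by
      simp [encode, List.length_flatMap]; ring
    have henc : encode (c :: L) =
        [c.1, c.2.length] ++ ((c.2.flatMap fun l => [l.1, l.2.toNat]) ++ encode L) := by
      simp [encode]
    rw [henc] at h0
    have g0 : s.arr 0 (s.reg 1 + 1) = c.2.length := by simpa using h0.left.tail.head
    have g1 : HoldsAt (s.arr 0) (s.reg 1 + 2) (c.2.flatMap fun l => [l.1, l.2.toNat]) :=
      h0.right.left
    have g2 : HoldsAt (s.arr 0) (s.reg 1 + 2 + 2 * c.2.length) (encode L) := by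
      have := h0.right.right
      simpa [List.length_flatMap, mul_comm] using this
    set s₁ : Memory := (Program.seq (.store 3 1 3) <| .seq (.add 1 1 5) <| .seq (.store 3 1 3) <|
      .seq (.load 7 0 1) <| .add 1 1 5).eval s with hs₁
    have a0 : s₁.arr = Function.update s.arr 3 (writeAt (s.arr 3) (s.reg 1) [s.reg 3, s.reg 3]) := by
      simp [hs₁, Program.eval, writeAt, h5]
    have a1 : s₁.reg 1 = s.reg 1 + 2 := by simp [hs₁, Program.eval, h5, add_assoc]
    have a7 : s₁.reg 7 = c.2.length := by simp [hs₁, Program.eval, h5, g0]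
    have ax : ∀ x, x ≠ 1 → x ≠ 7 → s₁.reg x = s.reg x := by
      intro x h1 h7; simp [hs₁, Program.eval, h1, h7]
    have main : Halts readClause s (11 * c.2.length + 8) fun s' =>
        s'.arr = Function.update (Function.update (Function.update s.arr
        1 (writeAt (s.arr 1) (s.reg 4) (List.replicate c.2.length (s.reg 3))))
        2 (writeAt (s.arr 2) (s.reg 4) (c.2.map fun l => l.1 + 1)))
        3 (writeAt (s.arr 3) (s.reg 1) (List.replicate (2 + 2 * c.2.length) (s.reg 3))) ∧
        s'.reg 0 = s.reg 0 ∧ s'.reg 1 = s.reg 1 + 2 + 2 * c.2.length ∧ s'.reg 3 = s.reg 3 + 1 ∧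
        s'.reg 4 = s.reg 4 + c.2.length ∧ s'.reg 5 = 1 ∧ s'.reg 2 = s'.reg 0 - s'.reg 1 ∧
        ∀ x, 8 ≤ x → s'.reg x = s.reg x := by
      refine (Halts.seq (B := 5) (B' := 11 * c.2.length + 1 + 2) (Q := fun s' => s' = s₁)
        (Halts.block rfl (by decide) rfl) ?_).mono (by omega) fun _ h => h
      rintro _ rfl
      refine Halts.seq (halts_readLiterals c.2 s₁ ?_ a7 ?_) ?_
      · rw [ax _ (by decide) (by decide), h5]
      · rw [a0, a1]; simpa using g1
      · rintro s' ⟨b1, b2, b3, b4, b5, b6, b7⟩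
        refine Halts.block rfl (by decide) ⟨?_, ?_, ?_, ?_, ?_, ?_, ?_, ?_⟩
        · simp only [Program.eval, Memory.arr_setReg, b1, a0, a1]
          rw [ax 3 (by decide) (by decide), ax 4 (by decide) (by decide), List.replicate_add,
            writeAt_append]
          funext a
          rcases eq_or_ne a 3 with rfl | h3
          · simp [List.replicate]
          rcases eq_or_ne a 2 with rfl | h2
          · simp
          rcases eq_or_ne a 1 with rfl | h1
          · simp
          simp [h3, h2, h1]
        · simp [Program.eval, b2, ax]
        · simp [Program.eval, b3, a1]
        · simp [Program.eval, b4, b6, ax]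
        · simp [Program.eval, b5, ax]
        · simp [Program.eval, b6]
        · simp [Program.eval]
        · intro x hx
          have : x ≠ 1 ∧ x ≠ 2 ∧ x ≠ 3 ∧ x ≠ 7 := by omega
          simp [Program.eval, b7 x hx, ax, this]
    refine (Halts.loop_pos (by rw [h2, hN, hlen]; omega) main
      (B' := 12 * (encode L).length + 1) ?_).mono (by rw [hlen]; omega) fun _ h => h
    rintro s' ⟨b1, b2, b3, b4, b5, b6, b7, b8⟩
    refine (ih s' b6 b7 ?_ ?_).mono le_rfl ?_
    · rw [b2, b3, hN, hlen]; omega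
    · rw [b1, b3]; simpa using g2
    · rintro s'' ⟨d1, d2, d3, d4, d5, d6⟩
      refine ⟨?_, ?_, ?_, ?_, d5, ?_⟩
      · rw [d1, b1, b3, b4, b5]
        simp only [edgesFrom, tagsFrom, List.map_append, writeAt_append, List.map_map,
          List.length_map, List.length_replicate]
        have e1 : (Prod.fst ∘ fun l : Literal => (s.reg 3, l.1 + 1)) = fun _ => s.reg 3 := rfl
        have e2 : (Prod.snd ∘ fun l : Literal => (s.reg 3, l.1 + 1)) = fun l => l.1 + 1 := rfl
        rw [e1, e2, List.map_const', ← add_assoc]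
        funext a
        rcases eq_or_ne a 3 with rfl | h3
        · simp
        rcases eq_or_ne a 2 with rfl | h2
        · simp
        rcases eq_or_ne a 1 with rfl | h1
        · simp
        simp [h3, h2, h1]
      · rw [d2, b2]
      · rw [d3, b4, List.length_cons]; omega
      · rw [d4, b5, b4]; simp [edgesFrom]; omega
      · intro x hx
        rw [d6 x hx, b8 x hx]

/-! ### Matching by prices -/

/-- Among the first `K` pairs of the arrays `a₁`, `a₂` is `(c, u)`. -/
def Edge (a₁ a₂ : ℕ → ℕ) (K c u : ℕ) : Prop := ∃ k < K, a₁ k = c ∧ a₂ k = u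

/-- The invariant of the matching algorithm: `own c` is the variable that is matched to the clause
`c` (or `0`), variables that are matched have a flag, and the price of the clause of a variable
exceeds that of the other clauses of this variable by at most `1`. -/
structure IsPriced (E : ℕ → ℕ → Prop) (price own flag : ℕ → ℕ) : Prop where
  edge : ∀ c, own c ≠ 0 → E c (own c)
  flag_ne_zero : ∀ c, own c ≠ 0 → flag (own c) ≠ 0
  le_add_one : ∀ c, own c ≠ 0 → ∀ c', E c' (own c) → price c ≤ price c' + 1
  exists_own : ∀ u, u ≠ 0 → flag u ≠ 0 → ∃ c, own c = u
  inj : ∀ c c', own c ≠ 0 → own c = own c' → c = c'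
  own_ne_zero : ∀ c, price c ≠ 0 → own c ≠ 0

lemma IsPriced.zero (E : ℕ → ℕ → Prop) :
    IsPriced E (fun _ => 0) (fun _ => 0) fun _ => 0 := by
  constructor <;> simp

/-- The new owner chose a cheapest clause, so after the rise this clause is at most 1 dearer than
its others. For the remaining owners, prices of alternatives only grow. The evicted owner loses its
flag, and clauses once matched stay matched. -/
lemma IsPriced.step {E : ℕ → ℕ → Prop} {price own flag : ℕ → ℕ}
    (h : IsPriced E price own flag) {c u : ℕ} (hu : u ≠ 0) (hf : flag u = 0) (hcu : E c u)
    (hmin : ∀ c', E c' u → price c ≤ price c') :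
    IsPriced E (Function.update price c (price c + 1)) (Function.update own c u)
      (Function.update (Function.update flag (own c) 0) u 1) := by
  have hle : ∀ x, price x ≤ Function.update price c (price c + 1) x := by
    intro x
    rcases eq_or_ne x c with rfl | hx
    · simp
    · simp [hx]
  have hne : ∀ x, own x ≠ 0 → own x ≠ u := fun x hx hxu => h.flag_ne_zero x hx (hxu ▸ hf)
  have hne' : ∀ x, x ≠ c → own x ≠ 0 → own x ≠ own c := fun x hx h0 heq => hx (h.inj x c h0 heq)
  constructor
  · intro x hx
    rcases eq_or_ne x c with rfl | hxc
    · simpa using hcu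
    · simp only [Function.update_of_ne hxc] at hx ⊢
      exact h.edge x hx
  · intro x hx
    rcases eq_or_ne x c with rfl | hxc
    · simp
    · simp only [Function.update_of_ne hxc] at hx ⊢
      rw [Function.update_of_ne (hne x hx), Function.update_of_ne (hne' x hxc hx)]
      exact h.flag_ne_zero x hx
  · intro x hx c' hc'
    rcases eq_or_ne x c with rfl | hxc
    · simp only [Function.update_self] at hc' ⊢
      have := hmin c' hc'
      have := hle c'
      omega
    · simp only [Function.update_of_ne hxc] at hx hc' ⊢
      have := h.le_add_one x hx c' hc'
      have := hle c'
      omega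
  · intro v hv hfv
    rcases eq_or_ne v u with rfl | hvu
    · exact ⟨c, by simp⟩
    · rw [Function.update_of_ne hvu] at hfv
      rcases eq_or_ne v (own c) with rfl | hvo
      · simp at hfv
      · rw [Function.update_of_ne hvo] at hfv
        obtain ⟨x, rfl⟩ := h.exists_own v hv hfv
        refine ⟨x, Function.update_of_ne ?_ _ _⟩
        rintro rfl
        exact hvo rfl
  · intro x y hx hxy
    rcases eq_or_ne x c with rfl | hxc <;> rcases eq_or_ne y x with rfl | hyx
    · rfl
    · rw [Function.update_self, Function.update_of_ne hyx] at hxy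
      exact absurd hxy.symm (hne y (hxy ▸ hu))
    · rfl
    · rw [Function.update_of_ne hxc] at hx hxy
      rcases eq_or_ne y c with rfl | hyc
      · rw [Function.update_self] at hxy
        exact absurd hxy (hne x hx)
      · rw [Function.update_of_ne hyc] at hxy
        exact h.inj x y hx hxy
  · intro x hx
    rcases eq_or_ne x c with rfl | hxc
    · simpa using hu
    · rw [Function.update_of_ne hxc] at hx ⊢
      exact h.own_ne_zero x hx

/-- The body of the search for a clause of the least price. -/
def scanBody : Program :=
  .seq (.sub 14 14 5) <| .seq (.load 15 2 14) <| .seq (.sub 16 15 10) <| .seq (.sub 17 10 15) <|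
  -- The sum of both truncated differences vanishes exactly if the two variables are equal.
  .seq (.add 16 16 17) <| .cond 16 .skip <|
    .seq (.load 15 1 14) <| .seq (.load 16 4 15) <| .seq (.sub 17 13 16) <|
    .cond 17 (.seq (.add 12 15 20) (.add 13 16 20)) .skip

/-- Among the clauses of the variable in register `10`, one of the least price is found: it is kept
in register `12`, and its price in register `13`. -/
lemma halts_scan (s₀ : Memory) (h5 : s₀.reg 5 = 1) (h20 : s₀.reg 20 = 0)
    (h14 : s₀.reg 14 = s₀.reg 4)
    (h12 : Edge (s₀.arr 1) (s₀.arr 2) (s₀.reg 4) (s₀.reg 12) (s₀.reg 10))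
    (h13 : s₀.reg 13 = s₀.arr 4 (s₀.reg 12)) :
    Halts (.loop 14 scanBody) s₀ (16 * s₀.reg 4 + 1) fun s =>
      s.arr = s₀.arr ∧ (∀ x, x < 12 ∨ x = 20 → s.reg x = s₀.reg x) ∧
      Edge (s₀.arr 1) (s₀.arr 2) (s₀.reg 4) (s.reg 12) (s₀.reg 10) ∧
      s.reg 13 = s₀.arr 4 (s.reg 12) ∧
      ∀ c, Edge (s₀.arr 1) (s₀.arr 2) (s₀.reg 4) c (s₀.reg 10) → s.reg 13 ≤ s₀.arr 4 c := by
  refine (Halts.loop (fun s => s.arr = s₀.arr ∧ (∀ x, x < 12 ∨ x = 20 → s.reg x = s₀.reg x) ∧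
      Edge (s₀.arr 1) (s₀.arr 2) (s₀.reg 4) (s.reg 12) (s₀.reg 10) ∧
      s.reg 13 = s₀.arr 4 (s.reg 12) ∧ s.reg 14 ≤ s₀.reg 4 ∧
      ∀ k, s.reg 14 ≤ k → k < s₀.reg 4 → s₀.arr 2 k = s₀.reg 10 → s.reg 13 ≤ s₀.arr 4 (s₀.arr 1 k))
    (fun s => s.reg 14) 15 ?_ s₀ ?_).mono ?_ ?_
  · rintro s ⟨g1, g2, g3, g4, g5, g6⟩ hx
    have e5 : s.reg 5 = 1 := by rw [g2 5 (by decide), h5]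
    have e10 : s.reg 10 = s₀.reg 10 := g2 10 (by decide)
    have e20 : s.reg 20 = 0 := by rw [g2 20 (by decide), h20]
    have hlt : s.reg 14 - 1 < s₀.reg 4 := by omega
    refine Halts.block rfl (by decide) ?_
    have hregs : ∀ x, x < 12 ∨ x = 20 → (scanBody.eval s).reg x = s₀.reg x := by
      intro x hx
      rw [← g2 x hx]
      refine Program.eval_reg ?_ s
      simp [scanBody, Program.regs]
      omega
    have harr : (scanBody.eval s).arr = s₀.arr := by
      rw [← g1]
      exact funext fun a => Program.eval_arr (by simp [scanBody, Program.arrs]) s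
    by_cases hv : s₀.arr 2 (s.reg 14 - 1) = s₀.reg 10
    · by_cases hp : s₀.arr 4 (s₀.arr 1 (s.reg 14 - 1)) < s.reg 13
      · have hpn : s.reg 13 - s₀.arr 4 (s₀.arr 1 (s.reg 14 - 1)) ≠ 0 := by omega
        have r12 : (scanBody.eval s).reg 12 = s₀.arr 1 (s.reg 14 - 1) := by
          simp [scanBody, Program.eval, e5, e10, e20, g1, hv, hpn]
        have r13 : (scanBody.eval s).reg 13 = s₀.arr 4 (s₀.arr 1 (s.reg 14 - 1)) := by
          simp [scanBody, Program.eval, e5, e10, e20, g1, hv, hpn]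
        have h14' : (scanBody.eval s).reg 14 = s.reg 14 - 1 := by
          simp [scanBody, Program.eval, e5, e10, g1, hv, hpn]
        refine ⟨⟨harr, hregs, ?_, ?_, ?_, ?_⟩, ?_⟩
        · rw [r12]; exact ⟨_, hlt, rfl, hv⟩
        · rw [r12, r13]
        · rw [h14']; omega
        · intro k hk hk' hkv
          rw [h14'] at hk
          rw [r13]
          rcases eq_or_ne k (s.reg 14 - 1) with rfl | hne
          · exact le_rfl
          · exact hp.le.trans (g6 k (by omega) hk' hkv)
        · rw [h14']; omega
      · have hpn : s.reg 13 - s₀.arr 4 (s₀.arr 1 (s.reg 14 - 1)) = 0 := by omega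
        have r12 : (scanBody.eval s).reg 12 = s.reg 12 := by
          simp [scanBody, Program.eval, e5, e10, g1, hv, hpn]
        have r13 : (scanBody.eval s).reg 13 = s.reg 13 := by
          simp [scanBody, Program.eval, e5, e10, g1, hv, hpn]
        have h14' : (scanBody.eval s).reg 14 = s.reg 14 - 1 := by
          simp [scanBody, Program.eval, e5, e10, g1, hv, hpn]
        refine ⟨⟨harr, hregs, ?_, ?_, ?_, ?_⟩, ?_⟩
        · rw [r12]; exact g3
        · rw [r12, r13, g4]
        · rw [h14']; omega
        · intro k hk hk' hkv
          rw [h14'] at hk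
          rw [r13]
          rcases eq_or_ne k (s.reg 14 - 1) with rfl | hne
          · omega
          · exact g6 k (by omega) hk' hkv
        · rw [h14']; omega
    · have hvn : s₀.arr 2 (s.reg 14 - 1) - s₀.reg 10 ≠ 0 ∨
          s₀.reg 10 - s₀.arr 2 (s.reg 14 - 1) ≠ 0 := by omega
      have r12 : (scanBody.eval s).reg 12 = s.reg 12 := by
        rcases hvn with h | h <;> simp [scanBody, Program.eval, e5, e10, g1, h]
      have r13 : (scanBody.eval s).reg 13 = s.reg 13 := by
        rcases hvn with h | h <;> simp [scanBody, Program.eval, e5, e10, g1, h]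
      have h14' : (scanBody.eval s).reg 14 = s.reg 14 - 1 := by
        rcases hvn with h | h <;> simp [scanBody, Program.eval, e5, e10, g1, h]
      refine ⟨⟨harr, hregs, ?_, ?_, ?_, ?_⟩, ?_⟩
      · rw [r12]; exact g3
      · rw [r12, r13, g4]
      · rw [h14']; omega
      · intro k hk hk' hkv
        rw [h14'] at hk
        rw [r13]
        rcases eq_or_ne k (s.reg 14 - 1) with rfl | hne
        · exact absurd hkv hv
        · exact g6 k (by omega) hk' hkv
      · rw [h14']; omega
  · exact ⟨rfl, fun _ _ => rfl, h12, h13, h14.le, fun k hk hk' => by omega⟩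
  · rw [h14]
  · rintro s ⟨⟨g1, g2, g3, g4, g5, g6⟩, g7⟩
    refine ⟨g1, g2, g3, g4, ?_⟩
    rintro c ⟨k, hk, rfl, hk'⟩
    exact g6 k (by omega) hk hk'

/-- Matches the variable in register `10` to the clause in register `12`, unless its price is
too high. -/
def assignBody : Program :=
  .seq (.sub 15 8 13) <| .cond 15
    -- The previous owner is evicted first. If there is none, the flag of the name 0 is cleared,
    -- which is harmless since names start at 1. At the end register `9` is reset, so that all
    -- occurrences are examined again.
    (.seq (.load 16 5 12) <| .seq (.store 6 16 20) <| .seq (.store 5 12 10) <|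
      .seq (.store 6 10 5) <| .seq (.add 13 13 5) <| .seq (.store 4 12 13) <| .add 9 4 20)
    .skip

/-- One round of the matching algorithm. -/
def matchBody : Program :=
  .seq (.seq (.sub 9 9 5) <| .seq (.load 10 2 9) <| .load 11 6 10) <|
  .cond 11 .skip <|
    .seq (.seq (.load 12 1 9) <| .seq (.load 13 4 12) <| .add 14 4 20) <|
    .seq (.loop 14 scanBody) assignBody

/-- The matching algorithm.  The arrays `4`, `5` and `6` hold the prices of the clauses, the
variables to which they are matched, and the flags of the variables. -/
def matchAll : Program :=
  .seq (.seq (.add 8 3 5) <| .seq (.add 8 8 5) <| .add 9 4 20) (.loop 9 matchBody)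

/-- The state of the matching algorithm. -/
structure MatchInv (s₀ s : Memory) : Prop where
  arr : ∀ a, a ≠ 4 → a ≠ 5 → a ≠ 6 → s.arr a = s₀.arr a
  reg : ∀ x, x < 8 ∨ x = 20 → s.reg x = s₀.reg x
  reg8 : s.reg 8 = s₀.reg 3 + 2
  reg9 : s.reg 9 ≤ s₀.reg 4
  priced : IsPriced (Edge (s₀.arr 1) (s₀.arr 2) (s₀.reg 4))
    (s.arr 4) (s.arr 5) (s.arr 6)
  done : ∀ k, s.reg 9 ≤ k → k < s₀.reg 4 → s.arr 6 (s₀.arr 2 k) ≠ 0 ∨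
    ∀ c, Edge (s₀.arr 1) (s₀.arr 2) (s₀.reg 4) c (s₀.arr 2 k) → s₀.reg 3 + 2 ≤ s.arr 4 c

/-- A bound for the number of rounds that are left. -/
def matchMeasure (s₀ s : Memory) : ℕ :=
  (∑ c ∈ Finset.range (s₀.reg 3), (s₀.reg 3 + 2 - s.arr 4 c)) * (s₀.reg 4 + 1) + s.reg 9

/-- A round either settles one more occurrence, because its variable is matched or all its clauses
have reached the cap, or it raises a price and starts over. -/
lemma halts_matchBody {s₀ : Memory} (h5 : s₀.reg 5 = 1) (h20 : s₀.reg 20 = 0)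
    (ha₁ : ∀ k < s₀.reg 4, s₀.arr 1 k < s₀.reg 3) (ha₂ : ∀ k < s₀.reg 4, s₀.arr 2 k ≠ 0)
    {s : Memory} (hs : MatchInv s₀ s) (h9 : s.reg 9 ≠ 0) :
    Halts matchBody s (16 * s₀.reg 4 + 17) fun s' =>
      MatchInv s₀ s' ∧ matchMeasure s₀ s' < matchMeasure s₀ s := by
  obtain ⟨g1, g2, g3, g4, g5, g6⟩ := hs
  have e5 : s.reg 5 = 1 := by rw [g2 5 (by decide), h5]
  have e20 : s.reg 20 = 0 := by rw [g2 20 (by decide), h20]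
  have e4 : s.reg 4 = s₀.reg 4 := g2 4 (by decide)
  have b1 := g1 1 (by decide) (by decide) (by decide)
  have b2 := g1 2 (by decide) (by decide) (by decide)
  set j := s.reg 9 - 1 with hj
  have hjK : j < s₀.reg 4 := by omega
  set u := s₀.arr 2 j with hu
  have hEu : Edge (s₀.arr 1) (s₀.arr 2) (s₀.reg 4) (s₀.arr 1 j) u := ⟨j, hjK, rfl, rfl⟩
  -- a memory that differs in the registers only
  have keep : ∀ s' : Memory, s'.arr = s.arr → (∀ x, x < 8 ∨ x = 20 → s'.reg x = s.reg x) →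
      s'.reg 8 = s.reg 8 → s'.reg 9 = j →
      (s.arr 6 u ≠ 0 ∨
        ∀ c, Edge (s₀.arr 1) (s₀.arr 2) (s₀.reg 4) c u → s₀.reg 3 + 2 ≤ s.arr 4 c) →
      MatchInv s₀ s' ∧ matchMeasure s₀ s' < matchMeasure s₀ s := by
    intro s' k1 k2 k3 k4 k5
    refine ⟨⟨fun a h1 h2 h3 => by rw [k1, g1 a h1 h2 h3], fun x hx => by rw [k2 x hx, g2 x hx],
      by rw [k3, g3], by omega, by rw [k1]; exact g5, ?_⟩, ?_⟩
    · intro k hk hk'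
      rw [k4] at hk
      rw [k1]
      rcases eq_or_ne k j with rfl | hne
      · exact k5
      · exact g6 k (by omega) hk'
    · simp only [matchMeasure, k1, k4]; omega
  set s₁ := (Program.seq (.sub 9 9 5) <| .seq (.load 10 2 9) <| .load 11 6 10).eval s with hs₁
  have c1 : s₁.arr = s.arr := rfl
  have c2 : ∀ x, x < 8 ∨ x = 20 → s₁.reg x = s.reg x := by
    intro x hx
    have : x ≠ 9 ∧ x ≠ 10 ∧ x ≠ 11 := by omega
    simp [hs₁, Program.eval, this]
  have c8 : s₁.reg 8 = s.reg 8 := by simp [hs₁, Program.eval]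
  have c9 : s₁.reg 9 = j := by simp [hs₁, Program.eval, e5, hj]
  have c10 : s₁.reg 10 = u := by simp [hs₁, Program.eval, e5, b2, hu, hj]
  have c11 : s₁.reg 11 = s.arr 6 u := by simp [hs₁, Program.eval, e5, b2, hu, hj]
  refine (Halts.seq (B := 3) (B' := 16 * s₀.reg 4 + 13 + 1) (Q := fun s' => s' = s₁)
    (Halts.block rfl (by decide) rfl) ?_).mono (by omega) fun _ h => h
  rintro _ rfl
  refine Halts.cond (fun h11 => ?_) fun h11 => ?_
  · refine Halts.block rfl (by simp [Program.cost]) ?_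
    exact keep s₁ c1 c2 c8 c9 (Or.inl (c11 ▸ h11))
  rw [c11] at h11
  set s₂ := (Program.seq (.load 12 1 9) <| .seq (.load 13 4 12) <| .add 14 4 20).eval s₁ with hs₂
  have d1 : s₂.arr = s.arr := rfl
  have d2 : ∀ x, x < 12 ∨ x = 20 → s₂.reg x = s₁.reg x := by
    intro x hx
    have : x ≠ 12 ∧ x ≠ 13 ∧ x ≠ 14 := by omega
    simp [hs₂, Program.eval, this]
  have d4 : s₂.reg 4 = s₀.reg 4 := by rw [d2 4 (by decide), c2 4 (by decide), e4]
  have d10 : s₂.reg 10 = u := by rw [d2 10 (by decide), c10]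
  have d12 : s₂.reg 12 = s₀.arr 1 j := by simp [hs₂, Program.eval, c1, c9, b1]
  have d13 : s₂.reg 13 = s.arr 4 (s₀.arr 1 j) := by simp [hs₂, Program.eval, c1, c9, b1]
  have d14 : s₂.reg 14 = s₀.reg 4 := by
    simp [hs₂, Program.eval, c2 4 (by decide), c2 20 (by decide), e4, e20]
  refine (Halts.seq (B := 3) (B' := 16 * s₀.reg 4 + 1 + 9) (Q := fun s' => s' = s₂)
    (Halts.block rfl (by decide) rfl) ?_).mono (by omega) fun _ h => h
  rintro _ rfl
  have hscan := halts_scan s₂ (by rw [d2 5 (by decide), c2 5 (by decide), e5])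
    (by rw [d2 20 (by decide), c2 20 (by decide), e20]) (by rw [d14, d4])
    (by rw [d1, d4, d10, d12, b1, b2]; exact hEu) (by rw [d13, d1, d12])
  rw [d1, d4, d10, b1, b2] at hscan
  refine Halts.seq hscan ?_
  rintro s₃ ⟨f1, f2, f3, f4, f5⟩
  set c := s₃.reg 12 with hc
  have f5' : s₃.reg 5 = 1 := by rw [f2 5 (by decide), d2 5 (by decide), c2 5 (by decide), e5]
  have f20 : s₃.reg 20 = 0 := by rw [f2 20 (by decide), d2 20 (by decide), c2 20 (by decide), e20]
  have f8 : s₃.reg 8 = s₀.reg 3 + 2 := by rw [f2 8 (by decide), d2 8 (by decide), c8, g3]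
  have f9 : s₃.reg 9 = j := by rw [f2 9 (by decide), d2 9 (by decide), c9]
  have f10 : s₃.reg 10 = u := by rw [f2 10 (by decide), d10]
  have f4' : s₃.reg 4 = s₀.reg 4 := by rw [f2 4 (by decide), d4]
  have fx : ∀ x, x < 8 ∨ x = 20 → s₃.reg x = s.reg x := by
    intro x hx
    rw [f2 x (by omega), d2 x (by omega), c2 x hx]
  refine Halts.block rfl (by decide) ?_
  by_cases hp : s.arr 4 c < s₀.reg 3 + 2
  · have hpn : s₀.reg 3 + 2 - s.arr 4 c ≠ 0 := by omega
    have r4 : (assignBody.eval s₃).arr 4 = Function.update (s.arr 4) c (s.arr 4 c + 1) := by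
      simp [assignBody, Program.eval, f8, f4, f5', f1, hpn, ← hc]
    have r5 : (assignBody.eval s₃).arr 5 = Function.update (s.arr 5) c u := by
      simp [assignBody, Program.eval, f8, f4, f10, f1, hpn, ← hc]
    have r6 : (assignBody.eval s₃).arr 6 =
        Function.update (Function.update (s.arr 6) (s.arr 5 c) 0) u 1 := by
      simp [assignBody, Program.eval, f8, f4, f5', f10, f20, f1, hpn, ← hc]
    have r9 : (assignBody.eval s₃).reg 9 = s₀.reg 4 := by
      simp [assignBody, Program.eval, f8, f4, f4', f20, hpn]
    have rx : ∀ x, x < 9 ∨ x = 20 → (assignBody.eval s₃).reg x = s₃.reg x := by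
      intro x hx
      have : x ≠ 9 ∧ x ≠ 13 ∧ x ≠ 15 ∧ x ≠ 16 := by omega
      simp [assignBody, Program.eval, f8, f4, hpn, this]
    have ra : ∀ a, a ≠ 4 → a ≠ 5 → a ≠ 6 → (assignBody.eval s₃).arr a = s.arr a := by
      intro a h1 h2 h3
      simp [assignBody, Program.eval, f8, f4, hpn, h1, h2, h3, f1]
    refine ⟨⟨fun a h1 h2 h3 => by rw [ra a h1 h2 h3, g1 a h1 h2 h3],
      fun x hx => by rw [rx x (by omega), fx x hx, g2 x hx], by rw [rx 8 (by decide), f8], r9.le,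
      ?_, fun k hk hk' => by omega⟩, ?_⟩
    · rw [r4, r5, r6]
      exact g5.step (ha₂ j hjK) h11 f3 (fun c' hc' => f4 ▸ f5 c' hc')
    · have hcm : c < s₀.reg 3 := by
        obtain ⟨k, hk, hkc, _⟩ := f3
        exact hkc ▸ ha₁ k hk
      have hsum : ∑ x ∈ Finset.range (s₀.reg 3),
          (s₀.reg 3 + 2 - Function.update (s.arr 4) c (s.arr 4 c + 1) x) + 1 =
          ∑ x ∈ Finset.range (s₀.reg 3), (s₀.reg 3 + 2 - s.arr 4 x) := by
        rw [← Finset.sum_erase_add _ _ (Finset.mem_range.2 hcm),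
          ← Finset.sum_erase_add (Finset.range (s₀.reg 3)) (fun x => s₀.reg 3 + 2 - s.arr 4 x)
            (Finset.mem_range.2 hcm), Function.update_self]
        have : ∀ x ∈ (Finset.range (s₀.reg 3)).erase c,
            s₀.reg 3 + 2 - Function.update (s.arr 4) c (s.arr 4 c + 1) x =
              s₀.reg 3 + 2 - s.arr 4 x := by
          intro x hx
          rw [Function.update_of_ne (Finset.ne_of_mem_erase hx)]
        rw [Finset.sum_congr rfl this]
        omega
      -- The rise of a price lowers the sum by 1, which is worth one more than the value to which
      -- register `9` is reset.
      simp only [matchMeasure, r4, r9]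
      rw [← hsum, add_mul]
      omega
  · have hpn : s₀.reg 3 + 2 - s.arr 4 c = 0 := by omega
    refine keep _ ?_ ?_ ?_ ?_ (Or.inr fun c' hc' => ?_)
    · simp [assignBody, Program.eval, f8, f4, hpn, f1]
    · intro x hx
      have : x ≠ 15 := by omega
      simp [assignBody, Program.eval, f8, f4, hpn, this, fx x hx]
    · simp [assignBody, Program.eval, f8, f4, hpn, g3]
    · simp [assignBody, Program.eval, f8, f4, hpn, f9]
    · have := f5 c' hc'
      omega

lemma halts_matchAll {s₀ : Memory} (h5 : s₀.reg 5 = 1) (h20 : s₀.reg 20 = 0)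
    (ha₁ : ∀ k < s₀.reg 4, s₀.arr 1 k < s₀.reg 3) (ha₂ : ∀ k < s₀.reg 4, s₀.arr 2 k ≠ 0)
    (h4 : s₀.arr 4 = fun _ => 0) (h5' : s₀.arr 5 = fun _ => 0) (h6 : s₀.arr 6 = fun _ => 0) :
    Halts matchAll s₀ ((16 * s₀.reg 4 + 17 + 1) *
      (s₀.reg 3 * (s₀.reg 3 + 2) * (s₀.reg 4 + 1) + s₀.reg 4) + 4) fun s =>
      MatchInv s₀ s ∧ s.reg 9 = 0 := by
  set s₁ := (Program.seq (.add 8 3 5) <| .seq (.add 8 8 5) <| .add 9 4 20).eval s₀ with hs₁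
  have hinv : MatchInv s₀ s₁ := by
    have r9 : s₁.reg 9 = s₀.reg 4 := by simp [hs₁, Program.eval, h20]
    refine ⟨fun _ _ _ _ => rfl, ?_, ?_, r9.le, ?_, fun k hk hk' => by omega⟩
    · intro x hx
      have : x ≠ 8 ∧ x ≠ 9 := by omega
      simp [hs₁, Program.eval, this]
    · simp [hs₁, Program.eval, h5]
    · have : s₁.arr = s₀.arr := rfl
      rw [this, h4, h5', h6]
      exact IsPriced.zero _
  have hmeas : matchMeasure s₀ s₁ =
      s₀.reg 3 * (s₀.reg 3 + 2) * (s₀.reg 4 + 1) + s₀.reg 4 := by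
    have : s₁.arr = s₀.arr := rfl
    simp [matchMeasure, this, h4]
    simp [hs₁, Program.eval, h20]
  have hloop := Halts.loop (MatchInv s₀) (matchMeasure s₀) (16 * s₀.reg 4 + 17)
    (fun s hs h9 => halts_matchBody h5 h20 ha₁ ha₂ hs h9) s₁ hinv
  rw [hmeas] at hloop
  refine (Halts.seq (B := 3) (Q := fun s' => s' = s₁) (Halts.block rfl (by decide) rfl)
    (B' := (16 * s₀.reg 4 + 17 + 1) *
      (s₀.reg 3 * (s₀.reg 3 + 2) * (s₀.reg 4 + 1) + s₀.reg 4) + 1) ?_).mono (by omega) fun _ h => h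
  rintro _ rfl
  exact hloop

/-! ### A price that does not occur -/

/-- Marks the prices of all clauses in array `7`. -/
def markPrices : Program :=
  .seq (.add 9 3 20) (.loop 9 (.seq (.sub 9 9 5) <| .seq (.load 15 4 9) (.store 7 15 5)))

/-- Finds the least positive number without a mark. -/
def findGap : Program :=
  .seq (.seq (.const 10 1) (.load 11 7 10)) (.loop 11 (.seq (.add 10 10 5) (.load 11 7 10)))

lemma halts_markPrices {s₀ : Memory} (h5 : s₀.reg 5 = 1) (h20 : s₀.reg 20 = 0)
    (h7 : s₀.arr 7 = fun _ => 0) :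
    Halts markPrices s₀ (4 * s₀.reg 3 + 2) fun s =>
      (∀ x, x < 8 ∨ x = 20 → s.reg x = s₀.reg x) ∧ (∀ a, a ≠ 7 → s.arr a = s₀.arr a) ∧
      ∀ p, s.arr 7 p ≠ 0 ↔ ∃ c < s₀.reg 3, s₀.arr 4 c = p := by
  have r9 : ((Program.add 9 3 20).eval s₀).reg 9 = s₀.reg 3 := by simp [Program.eval, h20]
  have hloop := Halts.loop (x := 9) (p := .seq (.sub 9 9 5) <| .seq (.load 15 4 9) (.store 7 15 5))
    (fun s => (∀ x, x < 8 ∨ x = 20 → s.reg x = s₀.reg x) ∧ (∀ a, a ≠ 7 → s.arr a = s₀.arr a) ∧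
      s.reg 9 ≤ s₀.reg 3 ∧ ∀ p, s.arr 7 p ≠ 0 ↔ ∃ c, s.reg 9 ≤ c ∧ c < s₀.reg 3 ∧ s₀.arr 4 c = p)
    (fun s => s.reg 9) 3 (by
      rintro s ⟨g1, g2, g3, g4⟩ h9
      have e5 : s.reg 5 = 1 := by rw [g1 5 (by decide), h5]
      have e4 := g2 4 (by decide)
      refine Halts.block rfl (by decide) ⟨⟨?_, ?_, ?_, ?_⟩, ?_⟩
      · intro x hx
        rw [← g1 x hx]
        exact Program.eval_reg (by simp [Program.regs]; omega) s
      · intro a ha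
        rw [← g2 a ha]
        exact Program.eval_arr (by simp [Program.arrs, ha]) s
      · simp [Program.eval, e5]; omega
      · intro p
        simp only [Program.eval, Memory.arr_setArr, Memory.arr_setReg, Memory.reg_setReg,
          Function.update_self, e5, e4, ne_eq, Memory.reg_setArr]
        rcases eq_or_ne p (s₀.arr 4 (s.reg 9 - 1)) with rfl | hp
        · simp only [Function.update_apply, e5]
          simp only [if_true]
          simp
          exact ⟨s.reg 9 - 1, by omega, by omega, rfl⟩
        · have := g4 p
          simp [e5, hp] at this ⊢
          rw [this]
          constructor
          · rintro ⟨c, h1, h2⟩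
            exact ⟨c, by omega, h2⟩
          · rintro ⟨c, h1, h2, h3⟩
            refine ⟨c, ?_, h2, h3⟩
            by_contra hc
            have : c = s.reg 9 - 1 := by omega
            exact hp (by rw [← h3, this])
      · simp [Program.eval, e5]; omega)
    ((Program.add 9 3 20).eval s₀) (by
      refine ⟨?_, fun _ _ => rfl, r9.le, ?_⟩
      · intro x hx
        exact Program.eval_reg (by simp [Program.regs]; omega) s₀
      · intro p
        rw [r9]
        simp only [Program.eval, Memory.arr_setReg, h7, ne_eq, not_true_eq_false, false_iff]
        rintro ⟨c, h1, h2, _⟩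
        omega)
  simp only [r9] at hloop
  refine (Halts.seq (B := 1) (Q := fun s' => s' = (Program.add 9 3 20).eval s₀)
    (Halts.block rfl (by decide) rfl) (B' := (3 + 1) * s₀.reg 3 + 1)
    (by rintro _ rfl; exact hloop)).mono (by omega) ?_
  rintro s ⟨⟨g1, g2, g3, g4⟩, g5⟩
  refine ⟨g1, g2, fun p => ?_⟩
  rw [g4, g5]
  simp

/-- Pigeonhole: m clauses take at most m prices, so a gap is found among 1, …, m + 1. -/
lemma le_of_forall_mem_image {m r : ℕ} {f : ℕ → ℕ}
    (h : ∀ i, 1 ≤ i → i ≤ r → ∃ c < m, f c = i) : r ≤ m := by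
  have : Finset.Icc 1 r ⊆ (Finset.range m).image f := by
    intro i hi
    obtain ⟨h1, h2⟩ := Finset.mem_Icc.1 hi
    obtain ⟨c, hc, hci⟩ := h i h1 h2
    exact Finset.mem_image.2 ⟨c, Finset.mem_range.2 hc, hci⟩
  simpa using (Finset.card_le_card this).trans Finset.card_image_le

lemma halts_findGap {s₀ : Memory} (h5 : s₀.reg 5 = 1) {m : ℕ} {f : ℕ → ℕ}
    (hf : ∀ p, s₀.arr 7 p ≠ 0 ↔ ∃ c < m, f c = p) :
    Halts findGap s₀ (3 * (m + 1) + 3) fun s =>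
      (∀ x, x < 8 ∨ x = 20 → s.reg x = s₀.reg x) ∧ s.arr = s₀.arr ∧
      1 ≤ s.reg 10 ∧ s.reg 10 ≤ m + 1 ∧ ∀ c < m, f c ≠ s.reg 10 := by
  set s₁ := (Program.seq (.const 10 1) (.load 11 7 10)).eval s₀ with hs₁
  have r10 : s₁.reg 10 = 1 := by simp [hs₁, Program.eval]
  have bound : ∀ r, (∀ i, 1 ≤ i → i < r + 1 → s₀.arr 7 i ≠ 0) → r ≤ m := fun r hr =>
    le_of_forall_mem_image fun i h1 h2 => (hf i).1 (hr i h1 (by omega))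
  have hloop := Halts.loop (x := 11) (p := .seq (.add 10 10 5) (.load 11 7 10))
    (fun s => (∀ x, x < 8 ∨ x = 20 → s.reg x = s₀.reg x) ∧ s.arr = s₀.arr ∧
      1 ≤ s.reg 10 ∧ s.reg 11 = s₀.arr 7 (s.reg 10) ∧ ∀ i, 1 ≤ i → i < s.reg 10 → s₀.arr 7 i ≠ 0)
    (fun s => m + 2 - s.reg 10) 2 (by
      rintro s ⟨g1, g2, g3, g4, g6⟩ h11
      have e5 : s.reg 5 = 1 := by rw [g1 5 (by decide), h5]
      have hall : ∀ i, 1 ≤ i → i < s.reg 10 + 1 → s₀.arr 7 i ≠ 0 := by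
        intro i h1 h2
        rcases eq_or_ne i (s.reg 10) with rfl | hi
        · rwa [← g4]
        · exact g6 i h1 (by omega)
      refine Halts.block rfl (by decide) ⟨⟨?_, ?_, ?_, ?_, ?_⟩, ?_⟩
      · intro x hx
        rw [← g1 x hx]
        exact Program.eval_reg (by simp [Program.regs]; omega) s
      · rw [← g2]
        exact funext fun a => Program.eval_arr (by simp [Program.arrs]) s
      · simp [Program.eval, e5]
      · simp [Program.eval, g2]
      · simpa [Program.eval, e5] using hall
      · have := bound _ hall
        simp [Program.eval, e5]; omega)
    s₁ (by
      refine ⟨?_, rfl, r10.ge, ?_, ?_⟩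
      · intro x hx
        exact Program.eval_reg (by simp [Program.regs]; omega) s₀
      · simp [hs₁, Program.eval]
      · intro i h1 h2; omega)
  simp only [r10] at hloop
  refine (Halts.seq (B := 2) (Q := fun s' => s' = s₁)
    (Halts.block rfl (by decide) rfl) (B' := (2 + 1) * (m + 2 - 1) + 1)
    (by rintro _ rfl; exact hloop)).mono (by omega) ?_
  rintro s ⟨⟨g1, g2, g3, g4, g6⟩, g5⟩
  refine ⟨g1, g2, g3, ?_, fun c hc hcs => ?_⟩
  · have := bound (s.reg 10 - 1) fun i h1 h2 => g6 i h1 (by omega)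
    omega
  · exact (hf _).2 ⟨c, hc, hcs⟩ (by rw [← g4, g5])

/-! ### Writing the output -/

/-- Keeps one number of the input if the price of its clause is greater than register `10`. -/
def writeBody : Program :=
  .seq (.load 13 3 1) <| .seq (.load 14 4 13) <| .seq (.sub 14 14 10) <|
  .seq (.cond 14 (.seq (.load 15 0 1) <| .seq (.store 0 12 15) (.add 12 12 5)) .skip) <|
  .seq (.add 1 1 5) (.sub 2 0 1)

/-- Writes the clauses the price of which is greater than register `10`. -/
def writeOutput : Program :=
  .seq (.seq (.const 1 0) <| .seq (.const 12 0) (.sub 2 0 1)) <|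
  .seq (.loop 2 writeBody) (.add 0 12 20)

/-- The list pairs each input number with the number of its clause. The output overwrites the input
in place; this is safe because the writing position never passes the reading position (`h12`). -/
lemma halts_writeLoop (l : List (ℕ × ℕ)) (s : Memory) (h5 : s.reg 5 = 1)
    (h2 : s.reg 2 = s.reg 0 - s.reg 1) (h0 : s.reg 0 = s.reg 1 + l.length)
    (hw : HoldsAt (s.arr 0) (s.reg 1) (l.map Prod.fst))
    (ht : HoldsAt (s.arr 3) (s.reg 1) (l.map Prod.snd)) (h12 : s.reg 12 ≤ s.reg 1) :
    Halts (.loop 2 writeBody) s (10 * l.length + 1) fun s' =>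
      s'.reg 12 = s.reg 12 + (l.filter fun q => s.reg 10 < s.arr 4 q.2).length ∧
      (∀ i < s.reg 12, s'.arr 0 i = s.arr 0 i) ∧
      HoldsAt (s'.arr 0) (s.reg 12) ((l.filter fun q => s.reg 10 < s.arr 4 q.2).map Prod.fst) ∧
      s'.reg 20 = s.reg 20 := by
  induction l generalizing s with
  | nil =>
    refine Halts.loop_zero ?_ ⟨rfl, fun _ _ => rfl, ?_, rfl⟩
    · rw [h2, h0]; simp
    · intro i hi; simp at hi
  | cons q l ih =>
    rw [List.map_cons] at hw ht
    have hq1 := hw.head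
    have hq2 := ht.head
    have hx : ∀ x, x ≠ 1 → x ≠ 2 → x ≠ 12 → x ≠ 13 → x ≠ 14 → x ≠ 15 →
        (writeBody.eval s).reg x = s.reg x := fun x g1 g2 g3 g4 g5 g6 =>
      Program.eval_reg (by simp [writeBody, Program.regs, g1, g2, g3, g4, g5, g6]) s
    have ha : ∀ a, a ≠ 0 → (writeBody.eval s).arr a = s.arr a := fun a h =>
      Program.eval_arr (by simp [writeBody, Program.arrs, h]) s
    have r10 := hx 10 (by decide) (by decide) (by decide) (by decide) (by decide) (by decide)
    have r0 := hx 0 (by decide) (by decide) (by decide) (by decide) (by decide) (by decide)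
    refine (Halts.loop_pos (B := 9) (B' := 10 * l.length + 1)
      (Q := fun s' => s' = writeBody.eval s) (by rw [h2, h0]; simp)
      (Halts.block rfl (by decide) rfl) ?_).mono (by simp; omega) fun _ h => h
    rintro _ rfl
    have hkey : (writeBody.eval s).reg 1 = s.reg 1 + 1 ∧
        (writeBody.eval s).reg 2 = s.reg 0 - (s.reg 1 + 1) ∧
        ((s.reg 10 < s.arr 4 q.2 ∧ (writeBody.eval s).reg 12 = s.reg 12 + 1 ∧
          (writeBody.eval s).arr 0 = Function.update (s.arr 0) (s.reg 12) q.1) ∨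
        (¬ s.reg 10 < s.arr 4 q.2 ∧ (writeBody.eval s).reg 12 = s.reg 12 ∧
          (writeBody.eval s).arr 0 = s.arr 0)) := by
      by_cases hlt : s.reg 10 < s.arr 4 q.2
      · have hn : s.arr 4 q.2 - s.reg 10 ≠ 0 := by omega
        refine ⟨?_, ?_, Or.inl ⟨hlt, ?_, ?_⟩⟩ <;>
          simp [writeBody, Program.eval, hq1, hq2, hn, h5]
      · have hn : s.arr 4 q.2 - s.reg 10 = 0 := by omega
        refine ⟨?_, ?_, Or.inr ⟨hlt, ?_, ?_⟩⟩ <;>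
          simp [writeBody, Program.eval, hq2, hn, h5]
    obtain ⟨r1, r2, hcase⟩ := hkey
    have ht' : HoldsAt ((writeBody.eval s).arr 3) ((writeBody.eval s).reg 1) (l.map Prod.snd) := by
      rw [ha 3 (by decide), r1]; exact ht.tail
    have hw' : HoldsAt ((writeBody.eval s).arr 0) ((writeBody.eval s).reg 1) (l.map Prod.fst) := by
      intro i hi
      have : (writeBody.eval s).arr 0 (s.reg 1 + 1 + i) = s.arr 0 (s.reg 1 + 1 + i) := by
        rcases hcase with ⟨_, _, h⟩ | ⟨_, _, h⟩
        · rw [h, Function.update_of_ne (by omega)]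
        · rw [h]
      rw [r1, this]
      exact hw.tail i hi
    have h12' : (writeBody.eval s).reg 12 ≤ (writeBody.eval s).reg 1 := by
      rw [r1]; rcases hcase with ⟨_, h, _⟩ | ⟨_, h, _⟩ <;> rw [h] <;> omega
    refine (ih (writeBody.eval s) ?_ ?_ ?_ hw' ht' h12').mono le_rfl ?_
    · rw [hx 5 (by decide) (by decide) (by decide) (by decide) (by decide) (by decide), h5]
    · rw [r2, r0, r1]
    · rw [r0, r1, h0, List.length_cons]; omega
    rintro s' ⟨g1, g2, g3, g4⟩
    rw [r10, ha 4 (by decide)] at g1 g3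
    have g20 : s'.reg 20 = s.reg 20 := by
      rw [g4, hx 20 (by decide) (by decide) (by decide) (by decide) (by decide) (by decide)]
    rcases hcase with ⟨hlt, k1, k2⟩ | ⟨hlt, k1, k2⟩
    · rw [k1] at g1 g2 g3
      rw [List.filter_cons_of_pos (by simpa using hlt)]
      refine ⟨by rw [g1, List.length_cons]; omega, fun i hi => ?_, ?_, g20⟩
      · rw [g2 i (by omega), k2, Function.update_of_ne (by omega)]
      · intro i hi
        cases i with
        | zero =>
          rw [add_zero, g2 _ (by omega), k2, Function.update_self]
          rfl
        | succ i =>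
          have := g3 i (by simpa using hi)
          rw [show s.reg 12 + (i + 1) = s.reg 12 + 1 + i by omega, this]
          rfl
    · rw [k1] at g1 g2 g3
      rw [List.filter_cons_of_neg (by simpa using hlt)]
      exact ⟨g1, fun i hi => by rw [g2 i hi, k2], g3, g20⟩

lemma halts_writeOutput (l : List (ℕ × ℕ)) (s : Memory) (h5 : s.reg 5 = 1) (h20 : s.reg 20 = 0)
    (h0 : s.reg 0 = l.length) (hw : HoldsAt (s.arr 0) 0 (l.map Prod.fst))
    (ht : HoldsAt (s.arr 3) 0 (l.map Prod.snd)) :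
    Halts writeOutput s (10 * l.length + 5) fun s' =>
      s'.output = (l.filter fun q => s.reg 10 < s.arr 4 q.2).map Prod.fst := by
  set s₁ := (Program.seq (.const 1 0) <| .seq (.const 12 0) (.sub 2 0 1)).eval s with hs₁
  have r1 : s₁.reg 1 = 0 := by simp [hs₁, Program.eval]
  have r2 : s₁.reg 2 = s.reg 0 := by simp [hs₁, Program.eval]
  have r12 : s₁.reg 12 = 0 := by simp [hs₁, Program.eval]
  have r0 : s₁.reg 0 = s.reg 0 := by simp [hs₁, Program.eval]
  have r5 : s₁.reg 5 = 1 := by simp [hs₁, Program.eval, h5]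
  have r10 : s₁.reg 10 = s.reg 10 := by simp [hs₁, Program.eval]
  have r20 : s₁.reg 20 = 0 := by simp [hs₁, Program.eval, h20]
  have ra : s₁.arr = s.arr := rfl
  refine (Halts.seq (B := 3) (B' := 10 * l.length + 1 + 1) (Q := fun s' => s' = s₁)
    (Halts.block rfl (by decide) rfl) ?_).mono (by omega) fun _ h => h
  rintro _ rfl
  refine Halts.seq (halts_writeLoop l s₁ r5 (by rw [r2, r0, r1, Nat.sub_zero])
    (by rw [r0, r1, h0, zero_add]) (by rw [ra, r1]; exact hw) (by rw [ra, r1]; exact ht)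
    (by rw [r12, r1])) ?_
  rintro s' ⟨g1, -, g3, g4⟩
  rw [r10, ra, r12] at g1 g3
  refine Halts.block rfl (by decide) ?_
  have k0 : ((Program.add 0 12 20).eval s').reg 0 =
      (l.filter fun q => s.reg 10 < s.arr 4 q.2).length := by
    simp [Program.eval, g1, g4, r20]
  apply List.ext_getElem
  · simp only [Memory.output, List.length_map, List.length_range, k0]
  · intro i h1 h2
    have := g3 i h2
    rw [zero_add] at this
    simpa [Memory.output, Program.eval] using this

/-! ### The complete program -/

/-- The program that finds a separating set of clauses. -/
def separate : Program :=
  .seq readInput <| .seq matchAll <| .seq markPrices <| .seq findGap writeOutput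

lemma mem_edgesFrom {e : ℕ} {L : ClauseList} {c u : ℕ} :
    (c, u) ∈ edgesFrom e L ↔ ∃ i v, c = e + i ∧ u = v + 1 ∧ Occurs L i v := by
  induction L generalizing e with
  | nil => simp [edgesFrom, Occurs]
  | cons a L ih =>
    rw [edgesFrom, List.mem_append, ih, List.mem_map]
    constructor
    · rintro (⟨⟨v, b⟩, h1, h2⟩ | ⟨i, v, rfl, rfl, h⟩)
      · obtain ⟨rfl, rfl⟩ := Prod.ext_iff.1 h2
        exact ⟨0, v, rfl, rfl, a, rfl, b, h1⟩
      · exact ⟨i + 1, v, by omega, rfl, by simpa [Occurs] using h⟩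
    · rintro ⟨i, v, rfl, rfl, h⟩
      cases i with
      | zero =>
        obtain ⟨a', h1, b, h2⟩ := h
        obtain rfl : a = a' := by simpa using h1
        exact Or.inl ⟨(v, b), h2, rfl⟩
      | succ i => exact Or.inr ⟨i, v, by omega, rfl, by simpa [Occurs] using h⟩

lemma length_encode_cons (c : ℕ × List Literal) (L : ClauseList) :
    (encode (c :: L)).length = 2 + 2 * c.2.length + (encode L).length := by
  simp [encode, List.length_flatMap]; ring

lemma length_edgesFrom_le (e : ℕ) (L : ClauseList) :
    (edgesFrom e L).length ≤ (encode L).length := by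
  induction L generalizing e with
  | nil => simp [edgesFrom]
  | cons c L ih =>
    have := ih (e + 1)
    rw [length_encode_cons, edgesFrom, List.length_append, List.length_map]
    omega

lemma length_le_length_encode (L : ClauseList) : L.length ≤ (encode L).length := by
  induction L with
  | nil => simp
  | cons c L ih => rw [length_encode_cons, List.length_cons]; omega

lemma length_tagsFrom (e : ℕ) (L : ClauseList) : (tagsFrom e L).length = (encode L).length := by
  induction L generalizing e with
  | nil => simp [tagsFrom, encode]
  | cons c L ih => rw [length_encode_cons, tagsFrom, List.length_append, ih, List.length_replicate]

lemma filter_zip_replicate (l : List ℕ) (e : ℕ) (keep : ℕ → Bool) :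
    ((l.zip (List.replicate l.length e)).filter fun q => keep q.2).map Prod.fst =
      if keep e then l else [] := by
  induction l with
  | nil => simp
  | cons a l ih =>
    rw [List.length_cons, List.replicate_succ, List.zip_cons_cons]
    by_cases h : keep e = true
    · rw [if_pos h] at ih ⊢
      rw [List.filter_cons_of_pos (by exact h), List.map_cons, ih]
    · rw [if_neg h] at ih ⊢
      rw [List.filter_cons_of_neg (by exact h), ih]

/-- All numbers of an entry carry the same tag and survive or vanish together, so filtering number
by number encodes the list of kept entries. -/
lemma filter_zip_tagsFrom (L : ClauseList) (e : ℕ) (keep : ℕ → Bool) :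
    (((encode L).zip (tagsFrom e L)).filter fun q => keep q.2).map Prod.fst =
      encode (((L.zipIdx e).filter fun p => keep p.2).map Prod.fst) := by
  induction L generalizing e with
  | nil => simp [encode, tagsFrom]
  | cons c L ih =>
    have h1 : encode (c :: L) = encode [c] ++ encode L := by simp [encode]
    have h2 : (encode [c]).length = 2 + 2 * c.2.length := by
      rw [length_encode_cons]; simp [encode]
    rw [h1, tagsFrom, ← h2, List.zip_append (by simp), List.filter_append, List.map_append, ih,
      filter_zip_replicate, List.zipIdx_cons]
    by_cases h : keep e = true
    · simp [h, encode]
    · simp [h]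

/-- A price that does not occur separates the clauses. -/
lemma separates_of_isPriced {L : ClauseList} {price own flag : ℕ → ℕ} {l : ℕ}
    (h : IsPriced (fun c u => ∃ v, u = v + 1 ∧ Occurs L c v) price own flag)
    (hdone : ∀ c v, Occurs L c v → flag (v + 1) ≠ 0 ∨ L.length + 2 ≤ price c)
    (hl1 : 1 ≤ l) (hl2 : l ≤ L.length + 1) (hl : ∀ c < L.length, price c ≠ l) :
    Separates L fun i => decide (l < price i) := by
  constructor
  -- A clause above the gap has a positive price and thus an owner, whose name is shifted back here.
  -- All clauses of this owner cost at least `l`, and none costs exactly `l`, so all are above the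
  -- gap.
  · refine ⟨fun i => own i - 1, fun i _ hi => ?_, fun i j _ _ hi hj hij => ?_⟩
    · rw [decide_eq_true_eq] at hi
      have h0 := h.own_ne_zero i (by omega)
      obtain ⟨v, hv, hiv⟩ := h.edge i h0
      have hx : own i - 1 = v := by omega
      dsimp only
      rw [hx]
      refine ⟨hiv, fun j hj => ?_⟩
      have h1 := h.le_add_one i h0 j ⟨v, hv, hj⟩
      have h2 := hl j hj.lt
      rw [decide_eq_true_eq]
      omega
    · rw [decide_eq_true_eq] at hi hj
      have h0 := h.own_ne_zero i (by omega)
      have h1 := h.own_ne_zero j (by omega)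
      exact h.inj i j h0 (by dsimp only at hij; omega)
  -- A clause that is not kept costs at most `l`, which is at most m + 1 and so below the cap m + 2.
  -- Its variables are therefore matched. Their own clauses cost at most 1 more than this clause,
  -- hence stay below the gap as well.
  · have hex : ∀ v i, Occurs L i v → decide (l < price i) = false → ∃ c, own c = v + 1 := by
      intro v i hi hk
      rw [decide_eq_false_iff_not] at hk
      rcases hdone i v hi with h1 | h1
      · exact h.exists_own _ (by omega) h1
      · omega
    classical
    refine ⟨fun v => if hv : ∃ c, own c = v + 1 then hv.choose else 0, fun v i hi hk => ?_,
      fun v i v' i' hi hk hi' hk' heq => ?_⟩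
    · have hv := hex v i hi hk
      have hc := hv.choose_spec
      simp only [hv, dif_pos]
      have h0 : own hv.choose ≠ 0 := by omega
      obtain ⟨v', hv', ho⟩ := h.edge _ h0
      have h1 := h.le_add_one _ h0 i ⟨v, hc, hi⟩
      have h2 := hl i hi.lt
      rw [decide_eq_false_iff_not] at hk ⊢
      refine ⟨?_, by omega⟩
      have : v' = v := by omega
      exact this ▸ ho
    · have hv := hex v i hi hk
      have hv' := hex v' i' hi' hk'
      simp only [hv, hv', dif_pos] at heq
      have h1 := hv.choose_spec
      have h2 := hv'.choose_spec
      rw [heq] at h1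
      omega

lemma holdsAt_getD (l : List ℕ) : HoldsAt (fun i => l.getD i 0) 0 l := by
  intro i hi
  simp [hi]

/-- The program finds a separating set of clauses in polynomial time. -/
theorem halts_separate (L : ClauseList) :
    Halts separate (Memory.init (encode L)) (99 * ((encode L).length + 2) ^ 4) fun s =>
      ∃ keep, Separates L keep ∧ s.output = encode (keepEntries L keep) := by
  set N := (encode L).length with hN
  set s₀ := Memory.init (encode L) with hs₀
  set K := (edgesFrom 0 L).length with hK
  have hKN : K ≤ N := length_edgesFrom_le 0 L
  have hmN : L.length ≤ N := length_le_length_encode L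
  -- the input is read
  have hread : Halts readInput s₀ (12 * N + 3) fun s =>
      (∀ i < K, s.arr 1 i = ((edgesFrom 0 L).map Prod.fst).getD i 0) ∧
      (∀ i < K, s.arr 2 i = ((edgesFrom 0 L).map Prod.snd).getD i 0) ∧
      HoldsAt (s.arr 3) 0 (tagsFrom 0 L) ∧ HoldsAt (s.arr 0) 0 (encode L) ∧
      (∀ a, 4 ≤ a → s.arr a = fun _ => 0) ∧
      s.reg 0 = N ∧ s.reg 3 = L.length ∧ s.reg 4 = K ∧ s.reg 5 = 1 ∧ s.reg 20 = 0 := by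
    set s₁ := (Program.seq (.const 5 1) (.sub 2 0 1)).eval s₀ with hs₁
    have r : ∀ x, x ≠ 0 → x ≠ 2 → x ≠ 5 → s₁.reg x = 0 := by
      intro x h0 h2 h5
      simp [hs₁, Program.eval, hs₀, Memory.init, h0, h2, h5]
    have r0 : s₁.reg 0 = N := by simp [hs₁, Program.eval, hs₀, Memory.init, hN]
    have r2 : s₁.reg 2 = N := by simp [hs₁, Program.eval, hs₀, Memory.init, hN]
    have r5 : s₁.reg 5 = 1 := by simp [hs₁, Program.eval]
    have a0 : s₁.arr 0 = fun i => (encode L).getD i 0 := rfl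
    have ax : ∀ a, a ≠ 0 → s₁.arr a = fun _ => 0 := by
      intro a ha
      funext i
      exact if_neg ha
    have r1 := r 1 (by decide) (by decide) (by decide)
    have r3 := r 3 (by decide) (by decide) (by decide)
    have r4 := r 4 (by decide) (by decide) (by decide)
    refine (Halts.seq (B := 2) (B' := 12 * N + 1) (Q := fun s' => s' = s₁)
      (Halts.block rfl (by decide) rfl) ?_).mono (by omega) fun _ h => h
    rintro _ rfl
    refine (halts_readClauses L s₁ r5 (by rw [r2, r0, r1, Nat.sub_zero])
      (by rw [r0, r1, zero_add]) (by rw [a0, r1]; exact holdsAt_getD _)).mono le_rfl ?_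
    rintro s ⟨g1, g2, g3, g4, g5, g6⟩
    rw [r1, r3, r4] at g1
    refine ⟨?_, ?_, ?_, ?_, ?_, by rw [g2, r0], by rw [g3, r3, zero_add],
      by rw [g4, r4, r3, zero_add], g5, ?_⟩
    · intro i hi
      have := writeAt_apply (s₁.arr 1) 0 ((edgesFrom 0 L).map Prod.fst) (i := i) (by simpa using hi)
      rw [zero_add] at this
      rw [g1, List.getD_eq_getElem _ _ (by simpa using hi)]
      simpa using this
    · intro i hi
      have := writeAt_apply (s₁.arr 2) 0 ((edgesFrom 0 L).map Prod.snd) (i := i) (by simpa using hi)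
      rw [zero_add] at this
      rw [g1, List.getD_eq_getElem _ _ (by simpa using hi)]
      simpa using this
    · rw [g1, Function.update_self]
      exact fun i hi => writeAt_apply _ 0 _ hi
    · rw [g1]
      simpa [a0] using holdsAt_getD (encode L)
    · intro a ha
      rw [g1, ← ax a (by omega)]
      have : a ≠ 1 ∧ a ≠ 2 ∧ a ≠ 3 := by omega
      simp [this]
    · rw [g6 20 (by decide), r 20 (by decide) (by decide) (by decide)]
  -- The auction dominates: O(m²K) rounds, each with a scan of the K occurrences, where m and K are
  -- at most N.
  have hbound : 12 * N + 3 + ((16 * K + 17 + 1) * (L.length * (L.length + 2) * (K + 1) + K) + 4 +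
      (4 * L.length + 2 + (3 * (L.length + 1) + 3 + (10 * N + 5)))) ≤ 99 * (N + 2) ^ 4 := by
    have h1 : (16 * K + 17 + 1) * (L.length * (L.length + 2) * (K + 1) + K) ≤
        (16 * N + 17 + 1) * (N * (N + 2) * (N + 1) + N) := by gcongr
    have h2 : (16 * N + 17 + 1) * (N * (N + 2) * (N + 1) + N) + (29 * N + 20) ≤
        99 * (N + 2) ^ 4 := by
      ring_nf
      nlinarith [Nat.zero_le N, Nat.zero_le (N ^ 2), Nat.zero_le (N ^ 3), Nat.zero_le (N ^ 4)]
    omega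
  refine (Halts.seq hread (B' := (16 * K + 17 + 1) * (L.length * (L.length + 2) * (K + 1) + K) + 4 +
    (4 * L.length + 2 + (3 * (L.length + 1) + 3 + (10 * N + 5)))) ?_).mono hbound fun _ h => h
  rintro s₁ ⟨g1, g2, g3, g4, g5, r0, r3, r4, r5, r20⟩
  have hget : ∀ k (hk : k < K), s₁.arr 1 k = ((edgesFrom 0 L)[k]).1 ∧
      s₁.arr 2 k = ((edgesFrom 0 L)[k]).2 := by
    intro k hk
    rw [g1 k hk, g2 k hk, List.getD_eq_getElem _ _ (by simpa using hk),
      List.getD_eq_getElem _ _ (by simpa using hk)]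
    simp
  have hEdge : Edge (s₁.arr 1) (s₁.arr 2) K = fun c u => ∃ v, u = v + 1 ∧ Occurs L c v := by
    funext c u
    refine propext ⟨?_, ?_⟩
    · rintro ⟨k, hk, rfl, rfl⟩
      have hmem : (edgesFrom 0 L)[k] ∈ edgesFrom 0 L := List.getElem_mem _
      obtain ⟨i, v, h1, h2, h3⟩ := mem_edgesFrom.1 hmem
      rw [zero_add] at h1
      rw [(hget k hk).1, (hget k hk).2]
      exact ⟨v, h2, h1 ▸ h3⟩
    · rintro ⟨v, rfl, h⟩
      have hmem : (c, v + 1) ∈ edgesFrom 0 L := mem_edgesFrom.2 ⟨c, v, by omega, rfl, h⟩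
      obtain ⟨k, hk, hkc⟩ := List.getElem_of_mem hmem
      exact ⟨k, hk, by rw [(hget k hk).1, hkc], by rw [(hget k hk).2, hkc]⟩
  have hE : ∀ k < K, ∃ v, s₁.arr 2 k = v + 1 ∧ Occurs L (s₁.arr 1 k) v := fun k hk => by
    have h : Edge (s₁.arr 1) (s₁.arr 2) K (s₁.arr 1 k) (s₁.arr 2 k) := ⟨k, hk, rfl, rfl⟩
    rwa [hEdge] at h
  have hmatch := halts_matchAll r5 r20
    (fun k hk => by
      obtain ⟨v, _, h⟩ := hE k (r4 ▸ hk)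
      rw [r3]; exact h.lt)
    (fun k hk => by
      obtain ⟨v, h, _⟩ := hE k (r4 ▸ hk)
      omega)
    (g5 4 (by decide)) (g5 5 (by decide)) (g5 6 (by decide))
  rw [r3, r4] at hmatch
  refine Halts.seq hmatch ?_
  rintro s₂ ⟨hinv, h9⟩
  have q : ∀ x, x < 8 ∨ x = 20 → s₂.reg x = s₁.reg x := hinv.reg
  have hmark := halts_markPrices (s₀ := s₂) (by rw [q 5 (by decide), r5])
    (by rw [q 20 (by decide), r20])
    (by rw [hinv.arr 7 (by decide) (by decide) (by decide), g5 7 (by decide)])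
  rw [q 3 (by decide), r3] at hmark
  refine Halts.seq hmark ?_
  rintro s₃ ⟨p1, p2, p3⟩
  refine Halts.seq (halts_findGap (by rw [p1 5 (by decide), q 5 (by decide), r5]) p3) ?_
  rintro s₄ ⟨t1, t2, t3, t4, t5⟩
  have hr : ∀ x, x < 8 ∨ x = 20 → s₄.reg x = s₁.reg x := fun x hx => by
    rw [t1 x hx, p1 x hx, q x hx]
  have ha : ∀ a, a ≠ 4 → a ≠ 5 → a ≠ 6 → a ≠ 7 → s₄.arr a = s₁.arr a := fun a h4 h5 h6 h7 => by
    rw [t2, p2 a h7, hinv.arr a h4 h5 h6]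
  have hlen : ((encode L).zip (tagsFrom 0 L)).length = N := by
    simp [length_tagsFrom, hN]
  have hwrite := halts_writeOutput ((encode L).zip (tagsFrom 0 L)) s₄
    (by rw [hr 5 (by decide), r5]) (by rw [hr 20 (by decide), r20])
    (by rw [hr 0 (by decide), r0, hlen])
    (by
      rw [ha 0 (by decide) (by decide) (by decide) (by decide),
        List.map_fst_zip (by rw [length_tagsFrom])]
      exact g4)
    (by
      rw [ha 3 (by decide) (by decide) (by decide) (by decide),
        List.map_snd_zip (by rw [length_tagsFrom])]
      exact g3)
  rw [hlen] at hwrite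
  refine hwrite.mono le_rfl ?_
  intro s hs
  have h4 : s₄.arr 4 = s₂.arr 4 := by rw [t2, p2 4 (by decide)]
  refine ⟨fun i => decide (s₄.reg 10 < s₂.arr 4 i), ?_, ?_⟩
  · have hp := hinv.priced
    rw [r4, hEdge] at hp
    refine separates_of_isPriced hp ?_ t3 t4 t5
    intro c v hcv
    have hmem : (c, v + 1) ∈ edgesFrom 0 L := mem_edgesFrom.2 ⟨c, v, by omega, rfl, hcv⟩
    obtain ⟨k, hk, hkc⟩ := List.getElem_of_mem hmem
    have hk2 : s₁.arr 2 k = v + 1 := by rw [(hget k hk).2, hkc]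
    have := hinv.done k (by omega) (r4 ▸ hk)
    rw [hk2, r3, r4, hEdge] at this
    exact this.imp_right fun h => h c ⟨v, rfl, hcv⟩
  · rw [hs, h4]
    exact filter_zip_tagsFrom L 0 fun i => decide (s₄.reg 10 < s₂.arr 4 i)

lemma length_le_bitLength (l : List ℕ) : l.length ≤ bitLength l := by
  induction l with
  | nil => simp
  | cons a l ih =>
    have : bitLength (a :: l) = Nat.size a + 1 + bitLength l := by simp [bitLength]
    rw [this, List.length_cons]
    omega

lemma length_encode_keepEntries_le (L : ClauseList) (keep : ℕ → Bool) :
    (encode (keepEntries L keep)).length ≤ (encode L).length := by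
  have := filter_zip_tagsFrom L 0 keep
  rw [keepEntries, ← this, List.length_map]
  refine (List.length_filter_le _ _).trans ?_
  simp

end MaxSat

/-- The program is correct on every list, so the function is read off from its runs; unit-conflict
freeness serves only for the bound. The output is no longer than the input, which raises the
constant 99 to 100, and the number of input numbers is at most the bit length. -/
theorem mainTheorem1 :
    ∃ f : MaxSat.ClauseList → MaxSat.ClauseList,
      MaxSat.PolyTimeComputable MaxSat.encode MaxSat.encode f ∧
      ∀ F : MaxSat.CNF, F.UnitConflictFree →
        ∀ L : MaxSat.ClauseList, MaxSat.Presents L F →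
          ∃ F' : MaxSat.CNF, MaxSat.Presents (f L) F' ∧ F'.IsSubformula F ∧
            (F.sat : ℝ) ≥ MaxSat.phi * (F.totalWeight : ℝ)
              + (1 - MaxSat.phi) * (F'.totalWeight : ℝ)
              + (2 - 3 * MaxSat.phi) * ((F.vars \ F'.vars).card : ℝ) / 2 := by
  choose s t hrun ht keep hkeep hout using MaxSat.halts_separate
  refine ⟨fun L => MaxSat.keepEntries L (keep L), ⟨MaxSat.separate,
    Polynomial.C 100 * (Polynomial.X + Polynomial.C 2) ^ 4, fun L => ⟨s L, t L, hrun L, hout L, ?_⟩⟩,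
    fun F hF L hL => hL.exists_subformula hF (hkeep L)⟩
  have h1 := ht L
  have h2 := MaxSat.length_encode_keepEntries_le L (keep L)
  have h3 := MaxSat.length_le_bitLength (MaxSat.encode L)
  rw [hout L]
  simp only [Polynomial.eval_mul, Polynomial.eval_C, Polynomial.eval_pow, Polynomial.eval_add,
    Polynomial.eval_X]
  have h4 : ((MaxSat.encode L).length + 2) ^ 4 ≤ (MaxSat.bitLength (MaxSat.encode L) + 2) ^ 4 := by
    gcongr
  have h5 : (MaxSat.encode L).length + 2 ≤ ((MaxSat.encode L).length + 2) ^ 4 :=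
    Nat.le_self_pow (by decide) _
  omega
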